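/- **Theorem 5.10.** Let $H$ be a real separable Hilbert space, and let $A\colon D(A)\subset H\to H$ be a linear self-adjoint operator with $\langle Ax,x\rangle\ge\delta|x|^2$ for all $x\in D(A)$ and some $\delta>0$, such that $A^{-1}$ is of trace class. Let $S(t)$, $t\ge 0$, be the strongly continuous semigroup on $H$ with infinitesimal generator $-A$. Put $Q:=\tfrac12A^{-1}$ and let $\mu$ be the Gaussian measure on $H$ with mean $0$ and covariance operator $Q$. Let $\Gamma=\{x\in H: g(x)\le 1\}$ with $\partial\Gamma=\{x\in H: g(x)=1\}$, where $g\colon H\to\mathbb R$ is a convex $C^\infty$ function with $g(0)=0$, $Dg(0)=0$ and $\langle D^2g(x)h,h\rangle\ge\gamma|h|^2$ for all $x,h\in H$ and some $\gamma>0$; assume that $D^2g$ is bounded on $\Gamma$ and $|Q^{1/2}Dg|^{-1}\in\bigcap_{1<p<\infty}L^p(H,\mu)$. Let $\mathbf n_\Gamma:=Dg/|Dg|$ on $\partial\Gamma$ be the exterior normal to $\Gamma$. Let $W$ be a cylindrical Wiener process in $H$ on a filtered probability space $(\Omega,\mathcal F,(\mathcal F_t)_{t\ge0},P)$, let $T>0$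 and $x\in H$, and consider the reflection problem $$dX(t)+\bigl(AX(t)+N_\Gamma(X(t))\bigr)\,dt\ni dW(t),\qquad X(0)=x, \tag{5.2}$$ where $N_\Gamma(y)=\{z\in H:\langle z,y'-y\rangle\le 0\ \ \forall y'\in\Gamma\}$. Consider pairs $(X_t,L_t)_{t\in[0,T]}$ of ($P$-a.s.) continuous, $(\mathcal F_t)$-adapted processes with values in $H\times\mathbb R$ such that $P$-a.s. $X_t\in\Gamma$ for all $t\in[0,T]$, $L$ is increasing (in the wide sense), and $I_{\partial\Gamma}(X_s)\,dL_s=dL_s$ on $[0,T]$. * Such a pair is a *solution* of (5.2) if for every $l\in D(A)$, $P$-a.s. for all $t\in[0,T]$, $$\langle l,X_t-x\rangle=\int_0^t\langle l,dW_s\rangle-\int_0^t\langle l,\mathbf n_\Gamma(X_s)\rangle\,dL_s-\int_0^t\langle Al,X_s\rangle\,ds .$$ * Such a pair is a *mild solution* of (5.2) if, $P$-a.s. for all $t\in[0,T]$, $$X_t=S(t)x+\int_0^tS(t-s)\,dW_s-\int_0^tS(t-s)\mathbf n_\Gamma(X_s)\,dL_s ,$$ where all the integrals are required to be well defined and $\int_0^tS(t-s)\,dW_s$,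 $t\in[0,T]$, denotes a version with $P$-a.s. continuous paths of the stochastic convolution. Then a pair $(X_t,L_t)_{t\in[0,T]}$ is a solution of (5.2) if and only if it is a mild solution of (5.2). -/

import Mathlib

open MeasureTheory ProbabilityTheory Filter Topology Set
open scoped NNReal ENNReal

noncomputable section

namespace ReflectedOU

/-! ### The operator and its semigroup -/

section Operators

variable {H : Type*} [NormedAddCommGroup H] [InnerProductSpace ℝ H]

/-- Trace class (nuclear) operators: `T = ∑ₖ ⟨aₖ, ·⟩ bₖ` with `∑ₖ ‖aₖ‖ ‖bₖ‖ < ∞`. -/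
def IsTraceClass (T : H →L[ℝ] H) : Prop :=
  ∃ a b : ℕ → H, Summable (fun k => ‖a k‖ * ‖b k‖) ∧
    ∀ x : H, HasSum (fun k => inner ℝ (a k) x • b k) (T x)

/-- `G` is the everywhere defined bounded inverse of the (unbounded) operator `A`. -/
structure IsBoundedInverse (A : H →ₗ.[ℝ] H) (G : H →L[ℝ] H) : Prop where
  right_inv : ∀ y : H, ∃ h : G y ∈ A.domain, A ⟨G y, h⟩ = y
  left_inv : ∀ x : A.domain, G (A x) = x

/-- `A` is self-adjoint, `⟨A x, x⟩ ≥ δ |x|²` on the domain of `A` for some `δ > 0`, and `A⁻¹`,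
here called `Ainv`, is of trace class. (Self-adjointness includes that `A` is densely defined.) -/
structure IsPositiveTraceInverse [CompleteSpace H] (A : H →ₗ.[ℝ] H) (Ainv : H →L[ℝ] H) :
    Prop where
  selfAdjoint : IsSelfAdjoint A
  coercive : ∃ δ : ℝ, 0 < δ ∧ ∀ x : A.domain, δ * ‖(x : H)‖ ^ 2 ≤ inner ℝ (A x) (x : H)
  inverse : IsBoundedInverse A Ainv
  traceClass : IsTraceClass Ainv

/-- `(S t)_{t ≥ 0}` is the strongly continuous semigroup whose infinitesimal generator is the
operator `B`: the graph of `B` consists of all `(x, y)` with `(S t x - x) / t → y` as `t ↓ 0`.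
(The values `S t` for `t < 0` are irrelevant.) -/
structure IsSemigroupGeneratedBy (S : ℝ → H →L[ℝ] H) (B : H →ₗ.[ℝ] H) : Prop where
  zero : S 0 = ContinuousLinearMap.id ℝ H
  add : ∀ s t : ℝ, 0 ≤ s → 0 ≤ t → S (s + t) = (S s).comp (S t)
  continuousOn : ∀ x : H, ContinuousOn (fun t => S t x) (Ici 0)
  generator : ∀ x y : H,
    Tendsto (fun t : ℝ => t⁻¹ • (S t x - x)) (𝓝[>] 0) (𝓝 y) ↔ (x, y) ∈ B.graph

/-- The squared Hilbert-Schmidt norm, `∑ₖ ‖Ψ eₖ‖²` for an orthonormal basis `(eₖ)`, written as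
the supremum of these sums over the finite orthonormal families. -/
def hsNormSq (Ψ : H →L[ℝ] H) : ℝ≥0∞ :=
  ⨆ (s : Finset H) (_ : Orthonormal ℝ (fun v : s => (v : H))), ∑ v ∈ s, ‖Ψ v‖ₑ ^ 2

end Operators

/-! ### The convex set -/

section ConvexSets

variable {H : Type*} [NormedAddCommGroup H] [InnerProductSpace ℝ H] [CompleteSpace H]

/-- `μ` is the Gaussian measure on `H` with mean `0` and covariance operator `Q`. -/
structure IsCenteredGaussian [MeasurableSpace H] [BorelSpace H]
    (Q : H →L[ℝ] H) (μ : Measure H) : Prop where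
  gaussian : IsGaussian μ
  mean : ∫ z, z ∂μ = 0
  covariance : ∀ h k : H, ∫ z, inner ℝ h z * inner ℝ k z ∂μ = inner ℝ (Q h) k

/-- `Γ = {g ≤ 1}` is a regular convex set: `g` is a convex `C^∞` function with `g(0) = 0`,
`Dg(0) = 0`, `D²g ≥ γ > 0`, `∂Γ = {g = 1}`, `D²g` bounded on `Γ`, and
`|Q^{1/2} Dg|⁻¹` in `L^p(μ)` for every finite `p > 1`. -/
structure IsRegularConvexSet [MeasurableSpace H] (Q : H →L[ℝ] H) (μ : Measure H)
    (g : H → ℝ) (Γ : Set H) : Prop where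
  convex : ConvexOn ℝ univ g
  smooth : ContDiff ℝ ((⊤ : ℕ∞) : WithTop ℕ∞) g
  map_zero : g 0 = 0
  gradient_zero : gradient g 0 = 0
  strictly_positive : ∃ γ : ℝ, 0 < γ ∧
    ∀ x h : H, γ * ‖h‖ ^ 2 ≤ fderiv ℝ (fderiv ℝ g) x h h
  sublevel : Γ = {x | g x ≤ 1}
  boundary : frontier Γ = {x | g x = 1}
  hessian_bounded : ∃ M : ℝ, ∀ x ∈ Γ, ‖fderiv ℝ (fderiv ℝ g) x‖ ≤ M
  inv_memLp : ∃ sqrtQ : H →L[ℝ] H, sqrtQ.IsPositive ∧ sqrtQ.comp sqrtQ = Q ∧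
    ∀ p : ℝ≥0, 1 < p → MemLp (fun x => ‖sqrtQ (gradient g x)‖⁻¹) p μ

/-- The exterior normal `Dg / |Dg|` (only used at points of `∂Γ = {g = 1}`, where `Dg ≠ 0`). -/
def exteriorNormal (g : H → ℝ) (x : H) : H := ‖gradient g x‖⁻¹ • gradient g x

end ConvexSets

/-! ### Cylindrical Wiener process and stochastic integral of operator-valued functions -/

section Wiener

variable {H : Type*} [NormedAddCommGroup H] [InnerProductSpace ℝ H]
variable {Ω : Type*} {mΩ : MeasurableSpace Ω}

/-- `W` is a cylindrical Wiener process in `H` on the filtered probability space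
`(Ω, (𝓕 t), P)`; `W t h` stands for `⟨h, W(t)⟩`. For every `h` the process `W · h` is an
`𝓕`-Brownian motion with variance parameter `‖h‖²`, and `h ↦ W t h` is linear up to null sets.
(Only the times `t ≥ 0` are relevant.) -/
structure IsCylindricalWiener (P : Measure Ω) (𝓕 : Filtration ℝ≥0 mΩ)
    (W : ℝ → H → Ω → ℝ) : Prop where
  adapted : ∀ (t : ℝ≥0) (h : H), StronglyMeasurable[𝓕 t] (W t h)
  zero : ∀ h : H, ∀ᵐ ω ∂P, W 0 h ω = 0
  linear : ∀ t : ℝ, 0 ≤ t → ∀ (a b : ℝ) (h k : H),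
    ∀ᵐ ω ∂P, W t (a • h + b • k) ω = a * W t h ω + b * W t k ω
  increment_law : ∀ (s t : ℝ≥0) (h : H), s ≤ t →
    P.map (fun ω => W t h ω - W s h ω) = gaussianReal 0 ((t - s) * ‖h‖₊ ^ 2)
  increment_indep : ∀ (s t : ℝ≥0) (h : H), s ≤ t →
    Indep (𝓕 s) (MeasurableSpace.comap (fun ω => W t h ω - W s h ω) inferInstance) P
  continuous : ∀ h : H, ∀ᵐ ω ∂P, ContinuousOn (fun t => W t h ω) (Ici 0)

/-- An elementary (deterministic) integrand on `[0, t]`: a step function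
`s ↦ ∑ᵢ 1_{(aᵢ, bᵢ]}(s) ⟨hᵢ, ·⟩ uᵢ` with values in the finite rank operators. -/
structure ElementaryIntegrand (H : Type*) (t : ℝ) where
  n : ℕ
  a : Fin n → ℝ
  b : Fin n → ℝ
  h : Fin n → H
  u : Fin n → H
  nonneg : ∀ i, 0 ≤ a i
  le : ∀ i, a i ≤ b i
  le_right : ∀ i, b i ≤ t

/-- The operator-valued function given by an elementary integrand. -/
def ElementaryIntegrand.toFun {t : ℝ} (φ : ElementaryIntegrand H t) (s : ℝ) : H →L[ℝ] H :=
  ∑ i, (Ioc (φ.a i) (φ.b i)).indicator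
    (fun _ => InnerProductSpace.rankOne ℝ (φ.u i) (φ.h i)) s

/-- The integral `∑ᵢ ⟨hᵢ, W(bᵢ) - W(aᵢ)⟩ uᵢ` of an elementary integrand. -/
def ElementaryIntegrand.integral {t : ℝ} (φ : ElementaryIntegrand H t) (W : ℝ → H → Ω → ℝ)
    (ω : Ω) : H :=
  ∑ i, (W (φ.b i) (φ.h i) ω - W (φ.a i) (φ.h i) ω) • φ.u i

/-- `I` is (a version of) the stochastic integral `∫₀ᵗ Φ(s) dW(s)` of the deterministic
operator-valued function `Φ`: there are elementary integrands that converge to `Φ` in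
`L²([0, t]; Hilbert-Schmidt operators)` and whose integrals converge to `I` in `L²(P; H)`. -/
def IsStochasticIntegral (P : Measure Ω) (W : ℝ → H → Ω → ℝ) (t : ℝ) (Φ : ℝ → H →L[ℝ] H)
    (I : Ω → H) : Prop :=
  AEStronglyMeasurable I P ∧
  ∃ φ : ℕ → ElementaryIntegrand H t,
    Tendsto (fun n => ∫⁻ s in Ioc 0 t, hsNormSq ((φ n).toFun s - Φ s)) atTop (𝓝 0) ∧
    Tendsto (fun n => ∫⁻ ω, ‖(φ n).integral W ω - I ω‖ₑ ^ 2 ∂P) atTop (𝓝 0)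

end Wiener

/-! ### The pathwise integrals with respect to `L` -/

/-- The path `f` on `[0, T]`, extended to the line by constants. -/
def clampPath (T : ℝ) (f : ℝ → ℝ) (s : ℝ) : ℝ := f (max 0 (min T s))

theorem clampPath_monotone {T : ℝ} {f : ℝ → ℝ} (hT : 0 ≤ T) (hf : MonotoneOn f (Icc 0 T)) :
    Monotone (clampPath T f) := fun _ _ hab =>
  hf ⟨le_max_left _ _, max_le hT (min_le_left _ _)⟩
    ⟨le_max_left _ _, max_le hT (min_le_left _ _)⟩
    (max_le_max le_rfl (min_le_min le_rfl hab))

open Classical in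
/-- The Lebesgue-Stieltjes measure `df` on `[0, T]` of a path `f` that is increasing
(that is, nondecreasing) and continuous on `[0, T]`. If `f` is not increasing on `[0, T]`,
the value is the zero measure. -/
def pathMeasure (T : ℝ) (f : ℝ → ℝ) : Measure ℝ :=
  if h : 0 ≤ T ∧ MonotoneOn f (Icc 0 T) then
    (clampPath_monotone h.1 h.2).stieltjesFunction.measure
  else 0

/-! ### Variational and mild solutions of the reflection problem -/

section Solutions

variable {H : Type*} [NormedAddCommGroup H] [InnerProductSpace ℝ H]
variable {Ω : Type*} {mΩ : MeasurableSpace Ω}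

/-- The requirements common to both notions of solution on `[0, T]`: `X` and `L` are continuous
adapted processes with values in `H` and `ℝ`, `X` stays in `Γ`, and `L` is increasing with
`1_{∂Γ}(X_s) dL_s = dL_s`. (Only the times `t ∈ [0, T]` are relevant.) -/
structure IsReflectedPair (P : Measure Ω) (𝓕 : Filtration ℝ≥0 mΩ) (T : ℝ) (Γ : Set H)
    (X : ℝ → Ω → H) (L : ℝ → Ω → ℝ) : Prop where
  adapted_X : ∀ t : ℝ≥0, (t : ℝ) ≤ T → StronglyMeasurable[𝓕 t] (X t)
  adapted_L : ∀ t : ℝ≥0, (t : ℝ) ≤ T → StronglyMeasurable[𝓕 t] (L t)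
  continuous_X : ∀ᵐ ω ∂P, ContinuousOn (fun t => X t ω) (Icc 0 T)
  continuous_L : ∀ᵐ ω ∂P, ContinuousOn (fun t => L t ω) (Icc 0 T)
  mem : ∀ᵐ ω ∂P, ∀ t ∈ Icc 0 T, X t ω ∈ Γ
  increasing : ∀ᵐ ω ∂P, MonotoneOn (fun t => L t ω) (Icc 0 T)
  boundary : ∀ᵐ ω ∂P, ∀ᵐ s ∂(pathMeasure T (fun s => L s ω)), X s ω ∈ frontier Γ

/-- Solutions in the variational sense; `n` is the exterior normal, and the stochastic integral
`∫₀ᵗ ⟨l, dW_s⟩` of the constant `l` is `⟨l, W(t)⟩ = W t l`. -/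
structure IsSolution (P : Measure Ω) (𝓕 : Filtration ℝ≥0 mΩ) (W : ℝ → H → Ω → ℝ)
    (A : H →ₗ.[ℝ] H) (Γ : Set H) (n : H → H) (T : ℝ) (x : H)
    (X : ℝ → Ω → H) (L : ℝ → Ω → ℝ) : Prop extends IsReflectedPair P 𝓕 T Γ X L where
  equation : ∀ l : A.domain, ∀ᵐ ω ∂P, ∀ t ∈ Icc 0 T,
    IntegrableOn (fun s => inner ℝ (l : H) (n (X s ω))) (Ioc 0 t)
      (pathMeasure T (fun s => L s ω)) ∧
    IntegrableOn (fun s => inner ℝ (A l) (X s ω)) (Ioc 0 t) ∧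
    inner ℝ (l : H) (X t ω - x) = W t l ω
      - ∫ s in Ioc 0 t, inner ℝ (l : H) (n (X s ω)) ∂(pathMeasure T (fun s => L s ω))
      - ∫ s in Ioc 0 t, inner ℝ (A l) (X s ω)

/-- Mild solutions; `Z` is a version of the stochastic convolution `∫₀ᵗ S(t-s) dW_s` with
continuous paths (it is unique up to indistinguishability). -/
structure IsMildSolution (P : Measure Ω) (𝓕 : Filtration ℝ≥0 mΩ) (W : ℝ → H → Ω → ℝ)
    (S : ℝ → H →L[ℝ] H) (Γ : Set H) (n : H → H) (T : ℝ) (x : H)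
    (X : ℝ → Ω → H) (L : ℝ → Ω → ℝ) : Prop extends IsReflectedPair P 𝓕 T Γ X L where
  equation : ∃ Z : ℝ → Ω → H,
    (∀ t ∈ Icc 0 T, IsStochasticIntegral P W t (fun s => S (t - s)) (Z t)) ∧
    (∀ᵐ ω ∂P, ContinuousOn (fun t => Z t ω) (Icc 0 T)) ∧
    ∀ᵐ ω ∂P, ∀ t ∈ Icc 0 T,
      IntegrableOn (fun s => S (t - s) (n (X s ω))) (Ioc 0 t)
        (pathMeasure T (fun s => L s ω)) ∧
      X t ω = S t x + Z t ω
        - ∫ s in Ioc 0 t, S (t - s) (n (X s ω)) ∂(pathMeasure T (fun s => L s ω))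

end Solutions

end ReflectedOU

end

/-!
The inverse of `A` is compact, self-adjoint and positive, so `H` has a Hilbert basis `(e k)` with
`A (e k) = lam k • e k`, `lam k > 0`, and `∑ₖ (lam k)⁻¹ < ∞` because the inverse has finite trace
(`IsPositiveTraceInverse.exists_isEigenbasis`). The semigroup is diagonal in this basis, with
entries `exp (-(lam k) t)` (`IsEigenbasis.inner_semigroup`). This turns both notions of solution
into statements about scalar paths.

*Along a path.* Tested with `e k`, the variational equation is the linear Volterra equation
`y(t) = F(t) - lam ∫₀ᵗ y(s) ds` for `y = ⟨e k, X⟩`, where `F` collects the initial value, the noise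
`W · (e k)` and the primitive of `⟨e k, n(X)⟩ dL`. Its unique continuous solution is
`ouPath lam F`, by `F(t) - lam ∫₀ᵗ exp (-lam (t - s)) F(s) ds` (`eq_ouPath_iff`). By linearity, and
by Fubini's theorem for the part with `dL` (`ouPath_integral`), this is the `k`-th coordinate of
the mild equation, with the noise entering as `ouPath (lam k) (W · (e k))`
(`IsEigenbasis.variational_iff_mild`).

*The noise.* It remains to recognise these scalar paths as the coordinates of the stochastic
convolution: `Z` is a version of `∫₀ᵗ S(t - s) dW(s)` if and only if
`⟨e k, Z⟩ = ouPath (lam k) (W · (e k)) t` almost surely for every `k`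
(`IsEigenbasis.inner_stochasticIntegral`, `IsEigenbasis.isStochasticIntegral`). Riemann sums of
`exp (-lam (t - s))` against a Brownian path converge to `ouPath` along each continuous path, by
summation by parts (`tendsto_riemannSum`); the Itô isometry for step functions and Fatou's lemma
then bound the mean square distance of `ouPath` to the integral of any step function
(`IsCylindricalWiener.lintegral_stepIntegral_sub_ouPath_le`). For the existence of approximating
elementary integrands, the Hilbert-Schmidt error and the mean square error are both bounded by the
same series, dominated by `∑ₖ (lam k)⁻¹`.

*Conclusion.* From a variational solution one defines the convolution as the difference of the
other terms of the mild equation; it is continuous since `dL` has no atoms, and has the right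
coordinates. From a mild solution one obtains the variational equation for every `e k`, then for
`l` in the domain of `A` by expanding `l` and `A l` in the basis
(`IsEigenbasis.ae_eq_of_forall_eigenvector`): `W t l` is the mean square limit of the corresponding
sums. Identities known at each time almost surely hold at all times by continuity of paths.
-/

namespace ReflectedOU

/-! ### The eigenbasis of the operator -/

section Eigenbasis

universe u

variable {H : Type u} [NormedAddCommGroup H] [InnerProductSpace ℝ H]

/-- The Hilbert basis `e` consists of eigenvectors of `A`, with positive eigenvalues `lam` whose
inverses are summable. -/
structure IsEigenbasis {ι : Type*} (A : H →ₗ.[ℝ] H) (e : HilbertBasis ι ℝ H) (lam : ι → ℝ) :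
    Prop where
  pos : ∀ k, 0 < lam k
  apply_eq : ∀ k, ∃ h : e k ∈ A.domain, A ⟨e k, h⟩ = lam k • e k
  summable_inv : Summable (fun k => (lam k)⁻¹)

theorem IsTraceClass.isCompactOperator [CompleteSpace H] {T : H →L[ℝ] H} (hT : IsTraceClass T) :
    IsCompactOperator T := by
  obtain ⟨a, b, hab, hsum⟩ := hT
  have hs : Summable (fun k => InnerProductSpace.rankOne ℝ (b k) (a k)) := by
    apply Summable.of_norm
    simpa [mul_comm] using hab
  have hlim : ∑' k, InnerProductSpace.rankOne ℝ (b k) (a k) = T := by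
    ext x
    have h1 := (ContinuousLinearMap.apply ℝ H x).hasSum hs.hasSum
    have h2 := hsum x
    simp only [ContinuousLinearMap.apply_apply, InnerProductSpace.rankOne_apply] at h1
    exact h1.unique h2
  have ht := hs.hasSum
  rw [hlim] at ht
  refine isCompactOperator_of_tendsto ht (Eventually.of_forall fun s => ?_)
  induction s using Finset.cons_induction with
  | empty => simpa using isCompactOperator_zero
  | cons k s hk ih =>
    rw [Finset.sum_cons]
    refine IsCompactOperator.add ?_ ih
    have : (InnerProductSpace.rankOne ℝ (b k) (a k) : H →L[ℝ] H)
        = (ContinuousLinearMap.toSpanSingleton ℝ (b k)).comp (innerSL ℝ (a k)) := by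
      ext x; simp
    rw [this]
    exact (isCompactOperator_of_locallyCompactSpace_rng
      (ContinuousLinearMap.toSpanSingleton ℝ (b k))).comp_clm _

/-- The trace of a trace class operator over an orthonormal family converges absolutely when its
terms are nonnegative: Cauchy-Schwarz and Bessel's inequality applied to `T = ∑ₖ ⟨aₖ, ·⟩ bₖ`. -/
theorem IsTraceClass.summable_inner {T : H →L[ℝ] H} (hT : IsTraceClass T) {ι : Type*} {e : ι → H}
    (he : Orthonormal ℝ e) (hpos : ∀ k, 0 ≤ inner ℝ (e k) (T (e k))) :
    Summable (fun k => inner ℝ (e k) (T (e k))) := by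
  obtain ⟨a, b, hab, hsum⟩ := hT
  refine summable_of_sum_le hpos (c := ∑' j, ‖a j‖ * ‖b j‖) fun u => ?_
  have h1 : HasSum (fun j => ∑ k ∈ u, inner ℝ (a j) (e k) * inner ℝ (e k) (b j))
      (∑ k ∈ u, inner ℝ (e k) (T (e k))) := by
    refine hasSum_sum fun k _ => ?_
    have := (innerSL ℝ (e k)).hasSum (hsum (e k))
    simpa [inner_smul_right] using this
  refine hasSum_le (fun j => ?_) h1 hab.hasSum
  have hB : ∀ x : H, ∑ k ∈ u, inner ℝ (e k) x ^ 2 ≤ ‖x‖ ^ 2 := fun x => by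
    simpa using he.sum_inner_products_le x (s := u)
  calc ∑ k ∈ u, inner ℝ (a j) (e k) * inner ℝ (e k) (b j)
      = ∑ k ∈ u, inner ℝ (e k) (a j) * inner ℝ (e k) (b j) := by
        simp only [real_inner_comm]
    _ ≤ √(∑ k ∈ u, inner ℝ (e k) (a j) ^ 2) * √(∑ k ∈ u, inner ℝ (e k) (b j) ^ 2) :=
        Real.sum_mul_le_sqrt_mul_sqrt _ _ _
    _ ≤ ‖a j‖ * ‖b j‖ := by
        gcongr
        · exact (Real.sqrt_le_sqrt (hB _)).trans_eq (Real.sqrt_sq (norm_nonneg _))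
        · exact (Real.sqrt_le_sqrt (hB _)).trans_eq (Real.sqrt_sq (norm_nonneg _))

theorem isSymmetric_of_isSelfAdjoint [CompleteSpace H] {A : H →ₗ.[ℝ] H} (hA : IsSelfAdjoint A)
    (x y : A.domain) : inner ℝ (A x) (y : H) = inner ℝ (x : H) (A y) := by
  have hd := hA.dense_domain
  have h := LinearPMap.adjoint_isFormalAdjoint hd
  have h2 : A.adjoint = A := hA
  rw [h2] at h
  exact h x y

variable [CompleteSpace H]

/-- The spectral theorem for the compact self-adjoint operator `A⁻¹`, read as a statement on `A`. -/
theorem IsPositiveTraceInverse.exists_isEigenbasis {A : H →ₗ.[ℝ] H} {G : H →L[ℝ] H}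
    (hA : IsPositiveTraceInverse A G) :
    ∃ (ι : Type u) (e : HilbertBasis ι ℝ H) (lam : ι → ℝ), IsEigenbasis A e lam := by
  have hsymA := isSymmetric_of_isSelfAdjoint hA.selfAdjoint
  have hsym : G.IsSymmetric := by
    intro x y
    obtain ⟨hx, hx'⟩ := hA.inverse.right_inv x
    obtain ⟨hy, hy'⟩ := hA.inverse.right_inv y
    have := hsymA ⟨G x, hx⟩ ⟨G y, hy⟩
    rw [hx', hy'] at this
    exact this.symm
  have hcomp := hA.traceClass.isCompactOperator
  have hbot := ContinuousLinearMap.orthogonalComplement_iSup_eigenspaces_eq_bot hcomp hsym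
  let E : ℝ → Submodule ℝ H := fun ν => Module.End.eigenspace (G : Module.End ℝ H) ν
  have hEmem : ∀ ν x, x ∈ E ν ↔ G x = ν • x := fun ν x => by
    simp [E]
  have hEcomplete : ∀ ν, CompleteSpace (E ν) := fun ν => by
    have : IsClosed (E ν : Set H) := by
      have : (E ν : Set H) = {x | G x = ν • x} := by ext x; exact hEmem ν x
      rw [this]
      exact isClosed_eq (by fun_prop) (by fun_prop)
    exact this.completeSpace_coe
  have hfam : OrthogonalFamily ℝ (fun ν => E ν) fun ν => (E ν).subtypeₗᵢ :=
    hsym.orthogonalFamily_eigenspaces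
  choose w b _ using fun ν => exists_hilbertBasis ℝ (E ν)
  have hon := hfam.orthonormal_sigma_orthonormal (fun ν => (b ν).orthonormal)
  have hspan : (Submodule.span ℝ (range fun a : Σ ν, w ν =>
      (E a.1).subtypeₗᵢ (b a.1 a.2)))ᗮ = ⊥ := by
    rw [eq_bot_iff, ← hbot]
    intro x hx
    rw [Submodule.mem_orthogonal] at hx
    rw [← Submodule.iInf_orthogonal, Submodule.mem_iInf]
    intro ν
    rw [Submodule.mem_orthogonal]
    intro u hu
    have h1 := (b ν).hasSum_repr ⟨u, hu⟩
    have h2 := ((innerSL ℝ x).comp (E ν).subtypeL).hasSum h1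
    have h3 : inner ℝ x u = 0 := by
      refine h2.unique ?_
      convert! hasSum_zero using 1
      funext i
      have := hx (b ν i : H) (Submodule.subset_span ⟨⟨ν, i⟩, rfl⟩)
      rw [real_inner_comm] at this
      simp [this]
    rw [real_inner_comm]; exact h3
  let e := HilbertBasis.mkOfOrthogonalEqBot hon hspan
  have he : ∀ a : Σ ν, w ν, e a = (b a.1 a.2 : H) := fun a => by
    simp [e]
  have hGe : ∀ a, G (e a) = a.1 • e a := fun a => by
    rw [he]; exact (hEmem _ _).1 (b a.1 a.2).2
  have hnorm : ∀ a, ‖e a‖ = 1 := e.orthonormal.1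
  have hin : ∀ a, inner ℝ (e a) (G (e a)) = a.1 := fun a => by
    rw [hGe, inner_smul_right, real_inner_self_eq_norm_sq, hnorm]; simp
  have hpos : ∀ a : Σ ν, w ν, 0 < a.1 := by
    intro a
    obtain ⟨δ, hδ, hc⟩ := hA.coercive
    obtain ⟨hm, hm'⟩ := hA.inverse.right_inv (e a)
    have h1 := hc ⟨G (e a), hm⟩
    rw [hm', hin] at h1
    have h2 : G (e a) ≠ 0 := fun h0 => by
      have h3 : A ⟨G (e a), hm⟩ = 0 := by
        have : (⟨G (e a), hm⟩ : A.domain) = 0 := by ext; simpa using h0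
        rw [this, LinearPMap.map_zero]
      rw [hm'] at h3
      have := hnorm a
      rw [h3] at this; simp at this
    have : 0 < ‖G (e a)‖ := norm_pos_iff.2 h2
    exact lt_of_lt_of_le (by positivity) h1
  refine ⟨Σ ν, w ν, e, fun a => (a.1)⁻¹, ⟨fun a => inv_pos.2 (hpos a), fun a => ?_, ?_⟩⟩
  · obtain ⟨hm, hm'⟩ := hA.inverse.right_inv ((a.1)⁻¹ • e a)
    have h1 : G ((a.1)⁻¹ • e a) = e a := by
      rw [map_smul, hGe, smul_smul, inv_mul_cancel₀ (hpos a).ne', one_smul]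
    simp only [h1] at hm hm'
    exact ⟨hm, hm'⟩
  · have := hA.traceClass.summable_inner e.orthonormal (fun a => by rw [hin]; exact (hpos a).le)
    simpa [hin] using this

end Eigenbasis

/-! ### The semigroup in the eigenbasis -/

section Semigroup

variable {H : Type*} [NormedAddCommGroup H] [InnerProductSpace ℝ H]
variable {ι : Type*} {A : H →ₗ.[ℝ] H} {e : HilbertBasis ι ℝ H} {lam : ι → ℝ} {S : ℝ → H →L[ℝ] H}

theorem HilbertBasis.hasSum_inner_smul (e : HilbertBasis ι ℝ H) (x : H) :
    HasSum (fun k => inner ℝ (e k) x • e k) x := by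
  simpa [e.repr_apply_apply] using e.hasSum_repr x

theorem HilbertBasis.hasSum_sq_inner (e : HilbertBasis ι ℝ H) (x : H) :
    HasSum (fun k => inner ℝ (e k) x ^ 2) (‖x‖ ^ 2) := by
  have := e.hasSum_inner_mul_inner x x
  rw [real_inner_self_eq_norm_sq] at this
  convert! this using 1
  funext k
  rw [real_inner_comm x, sq]

theorem HilbertBasis.tsum_ofReal_sq_inner (e : HilbertBasis ι ℝ H) (x : H) :
    ∑' k, ENNReal.ofReal (inner ℝ (e k) x ^ 2) = ‖x‖ₑ ^ 2 := by
  have h := HilbertBasis.hasSum_sq_inner e x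
  rw [← ENNReal.ofReal_tsum_of_nonneg (fun k => sq_nonneg _) h.summable, h.tsum_eq,
    ENNReal.ofReal_pow (norm_nonneg _), ofReal_norm]

/-- Parseval's identity. -/
theorem HilbertBasis.tsum_enorm_sq_inner (e : HilbertBasis ι ℝ H) (x : H) :
    ∑' k, ‖inner ℝ (e k) x‖ₑ ^ 2 = ‖x‖ₑ ^ 2 := by
  rw [← HilbertBasis.tsum_ofReal_sq_inner e x]
  congr 1; funext k
  rw [← sq_abs, ENNReal.ofReal_pow (abs_nonneg _), ← Real.norm_eq_abs, ofReal_norm]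

theorem IsEigenbasis.semigroup_apply (he : IsEigenbasis A e lam)
    (hS : IsSemigroupGeneratedBy S (-A)) {t : ℝ} (ht : 0 ≤ t) (k : ι) :
    S t (e k) = Real.exp (-(lam k) * t) • e k := by
  obtain ⟨hm, hAe⟩ := he.apply_eq k
  -- `t ↦ exp (lam t) S(t) e` is continuous with vanishing right derivative, hence constant; only
  -- right derivatives are available from the definition of the generator.
  have hgen : Tendsto (fun t : ℝ => t⁻¹ • (S t (e k) - e k)) (𝓝[>] 0) (𝓝 (-(lam k) • e k)) := by
    rw [hS.generator, LinearPMap.mem_graph_iff]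
    refine ⟨⟨e k, hm⟩, rfl, ?_⟩
    rw [LinearPMap.neg_apply]
    simp only [neg_smul, neg_inj]
    exact hAe
  have hderiv : ∀ s, 0 ≤ s →
      HasDerivWithinAt (fun r => S r (e k)) (-(lam k) • S s (e k)) (Ici s) s := by
    intro s hs
    rw [hasDerivWithinAt_iff_tendsto_slope]
    have h1 : Tendsto (fun r => S s ((r - s)⁻¹ • (S (r - s) (e k) - e k))) (𝓝[>] s)
        (𝓝 (S s (-(lam k) • e k))) := by
      refine ((S s).continuous.tendsto _).comp (hgen.comp ?_)
      refine tendsto_nhdsWithin_iff.2 ⟨?_, ?_⟩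
      · have : Tendsto (fun r => r - s) (𝓝 s) (𝓝 (s - s)) :=
          (continuous_id.sub continuous_const).tendsto s
        rw [sub_self] at this
        exact this.mono_left nhdsWithin_le_nhds
      · filter_upwards [self_mem_nhdsWithin] with r hr
        simpa using hr
    rw [map_smul] at h1
    have hset : Ici s \ {s} = Ioi s := by
      ext r; simp [lt_iff_le_and_ne]
    rw [hset]
    refine h1.congr' ?_
    filter_upwards [self_mem_nhdsWithin] with r hr
    have hr' : 0 ≤ r - s := by have : s < r := hr; linarith
    have h2 : S r (e k) = S s (S (r - s) (e k)) := by
      have := hS.add s (r - s) hs hr'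
      rw [add_sub_cancel] at this
      rw [this]; rfl
    rw [slope_def_module, h2, map_smul, map_sub]
  have hexp : ∀ s, HasDerivAt (fun r => Real.exp (lam k * r)) (lam k * Real.exp (lam k * s)) s := by
    intro s
    have := ((hasDerivAt_id s).const_mul (lam k)).exp
    simpa [mul_comm] using this
  have hconst := constant_of_has_deriv_right_zero (a := 0) (b := t)
    (f := fun r => Real.exp (lam k * r) • S r (e k))
    (by
      refine ContinuousOn.smul (by fun_prop) ?_
      exact (hS.continuousOn (e k)).mono Icc_subset_Ici_self)
    (fun s hs => by
      have := (hexp s).hasDerivWithinAt.smul (hderiv s hs.1)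
      convert! this using 1
      module) t ⟨ht, le_rfl⟩
  simp only [mul_zero, Real.exp_zero, one_smul, hS.zero, ContinuousLinearMap.id_apply] at hconst
  conv_rhs => rw [← hconst, smul_smul, ← Real.exp_add]
  simp

theorem IsEigenbasis.inner_semigroup (he : IsEigenbasis A e lam)
    (hS : IsSemigroupGeneratedBy S (-A)) {t : ℝ} (ht : 0 ≤ t) (k : ι) (x : H) :
    inner ℝ (e k) (S t x) = Real.exp (-(lam k) * t) * inner ℝ (e k) x := by
  classical
  have h := ((innerSL ℝ (e k)).comp (S t)).hasSum (HilbertBasis.hasSum_inner_smul e x)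
  refine h.unique ?_
  convert! hasSum_ite_eq k (Real.exp (-(lam k) * t) * inner ℝ (e k) x) using 1
  funext j
  have := orthonormal_iff_ite.1 e.orthonormal k j
  simp only [ContinuousLinearMap.comp_apply, map_smul, he.semigroup_apply hS ht,
    innerSL_apply_apply, smul_eq_mul, this]
  by_cases hj : j = k
  · subst hj; simp [mul_comm]
  · simp [hj, Ne.symm hj]

theorem IsEigenbasis.norm_semigroup_le (he : IsEigenbasis A e lam)
    (hS : IsSemigroupGeneratedBy S (-A)) {t : ℝ} (ht : 0 ≤ t) (x : H) : ‖S t x‖ ≤ ‖x‖ := by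
  refine le_of_sq_le_sq ?_ (norm_nonneg _)
  refine hasSum_le (fun k => ?_) (HilbertBasis.hasSum_sq_inner e (S t x))
    (HilbertBasis.hasSum_sq_inner e x)
  rw [he.inner_semigroup hS ht, mul_pow]
  refine mul_le_of_le_one_left (sq_nonneg _) ?_
  refine pow_le_one₀ (Real.exp_nonneg _) (Real.exp_le_one_iff.2 ?_)
  have := he.pos k
  nlinarith

/-- Contractivity makes the strongly continuous semigroup, extended to negative times by the
identity, jointly continuous. -/
theorem IsEigenbasis.continuous_semigroup (he : IsEigenbasis A e lam)
    (hS : IsSemigroupGeneratedBy S (-A)) :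
    Continuous (fun p : ℝ × H => S (max p.1 0) p.2) := by
  rw [continuous_iff_continuousAt]
  rintro ⟨t, x⟩
  have h1 : Continuous (fun r : ℝ => S (max r 0) x) :=
    (hS.continuousOn x).comp_continuous (by fun_prop) (fun r => mem_Ici.2 (le_max_right _ _))
  have h2 : Tendsto (fun p : ℝ × H => S (max p.1 0) x) (𝓝 (t, x)) (𝓝 (S (max t 0) x)) :=
    (h1.comp continuous_fst).tendsto (t, x)
  have h3 : Tendsto (fun p : ℝ × H => S (max p.1 0) (p.2 - x)) (𝓝 (t, x)) (𝓝 0) := by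
    refine squeeze_zero_norm (fun p => he.norm_semigroup_le hS (le_max_right _ _) _) ?_
    have : Continuous (fun p : ℝ × H => ‖p.2 - x‖) := by fun_prop
    simpa using this.tendsto (t, x)
  have := h2.add h3
  simp only [add_zero] at this
  refine this.congr fun p => ?_
  rw [map_sub]; abel

end Semigroup

/-! ### Hilbert-Schmidt norms -/

section HilbertSchmidt

variable {H : Type*} [NormedAddCommGroup H] [InnerProductSpace ℝ H]

theorem enorm_sq_le_hsNormSq (Ψ : H →L[ℝ] H) {v : H} (hv : ‖v‖ = 1) :
    ‖Ψ v‖ₑ ^ 2 ≤ hsNormSq Ψ := by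
  have ho : Orthonormal ℝ (fun u : ({v} : Finset H) => (u : H)) := by
    constructor
    · rintro ⟨u, hu⟩
      simp only [Finset.mem_singleton] at hu
      simpa [hu] using hv
    · rintro ⟨u, hu⟩ ⟨u', hu'⟩ h
      simp only [Finset.mem_singleton] at hu hu'
      exact absurd (Subtype.ext (hu.trans hu'.symm)) h
  have := le_iSup₂ (f := fun (s : Finset H) (_ : Orthonormal ℝ (fun v : s => (v : H))) =>
    ∑ v ∈ s, ‖Ψ v‖ₑ ^ 2) {v} ho
  simpa [hsNormSq] using this

/-- The adjoint is controlled by the Hilbert-Schmidt norm as well: if every `⟨f, Ψ v⟩` equals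
`⟨u, v⟩`, that is `u = Ψ* f`, and `f` is a unit vector, then `‖u‖² ≤ ‖Ψ‖²_HS`. -/
theorem enorm_sq_adjoint_le_hsNormSq (Ψ : H →L[ℝ] H) {f u : H} (hf : ‖f‖ = 1)
    (h : ∀ v, inner ℝ f (Ψ v) = inner ℝ u v) : ‖u‖ₑ ^ 2 ≤ hsNormSq Ψ := by
  by_cases hu : u = 0
  · simp [hu]
  have hu0 : 0 < ‖u‖ := norm_pos_iff.2 hu
  have h1 : ‖u‖ ^ 2 ≤ ‖Ψ u‖ := by
    rw [← real_inner_self_eq_norm_sq, ← h u]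
    exact (real_inner_le_norm _ _).trans (by rw [hf, one_mul])
  have h2 := enorm_sq_le_hsNormSq Ψ (v := ‖u‖⁻¹ • u) (by simp [norm_smul, hu0.ne'])
  refine le_trans ?_ h2
  gcongr
  rw [← ofReal_norm, ← ofReal_norm]
  refine ENNReal.ofReal_le_ofReal ?_
  rw [map_smul, norm_smul, norm_inv, norm_norm, inv_mul_eq_div, le_div_iff₀ hu0, ← sq]
  exact h1

/-- An operator that is diagonal in a Hilbert basis with entries `d k` has squared Hilbert-Schmidt
norm at most `∑ₖ (d k)²`. -/
theorem hsNormSq_le_of_diagonal {ι : Type*} (e : HilbertBasis ι ℝ H) (Ψ : H →L[ℝ] H) (d : ι → ℝ)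
    (hd : ∀ k v, inner ℝ (e k) (Ψ v) = d k * inner ℝ (e k) v) :
    hsNormSq Ψ ≤ ∑' k, ENNReal.ofReal (d k ^ 2) := by
  refine iSup₂_le fun s hs => ?_
  calc ∑ v ∈ s, ‖Ψ v‖ₑ ^ 2
      = ∑ v ∈ s, ∑' k, ENNReal.ofReal (d k ^ 2) * ENNReal.ofReal (inner ℝ (e k) v ^ 2) := by
        refine Finset.sum_congr rfl fun v _ => ?_
        rw [← HilbertBasis.tsum_ofReal_sq_inner e]
        congr 1; funext k
        rw [hd, mul_pow, ENNReal.ofReal_mul (sq_nonneg _)]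
    _ = ∑' k, ENNReal.ofReal (d k ^ 2) * ∑ v ∈ s, ENNReal.ofReal (inner ℝ (e k) v ^ 2) := by
        rw [← Summable.tsum_finsetSum (fun _ _ => ENNReal.summable)]
        congr 1; funext k
        rw [Finset.mul_sum]
    _ ≤ ∑' k, ENNReal.ofReal (d k ^ 2) := by
        refine ENNReal.tsum_le_tsum fun k => mul_le_of_le_one_right' ?_
        rw [← ENNReal.ofReal_sum_of_nonneg (fun _ _ => sq_nonneg _), ← ENNReal.ofReal_one]
        refine ENNReal.ofReal_le_ofReal ?_
        have h := hs.sum_inner_products_le (e k) (s := Finset.univ)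
        rw [e.orthonormal.1 k, Finset.univ_eq_attach] at h
        rw [← Finset.sum_attach]
        simpa [real_inner_comm] using h

end HilbertSchmidt

/-! ### Second moments of the cylindrical Wiener process -/

section Covariance

variable {H : Type*} [NormedAddCommGroup H] [InnerProductSpace ℝ H]
variable {Ω : Type*} {mΩ : MeasurableSpace Ω} {P : Measure Ω} {𝓕 : Filtration ℝ≥0 mΩ}
  {W : ℝ → H → Ω → ℝ}

theorem IsCylindricalWiener.measurable (hW : IsCylindricalWiener P 𝓕 W) {t : ℝ} (ht : 0 ≤ t)
    (h : H) : Measurable (W t h) :=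
  ((hW.adapted ⟨t, ht⟩ h).mono (𝓕.le _)).measurable

theorem IsCylindricalWiener.map_increment (hW : IsCylindricalWiener P 𝓕 W) {s t : ℝ} (hs : 0 ≤ s)
    (hst : s ≤ t) (h : H) :
    ∃ v : ℝ≥0, (v : ℝ) = (t - s) * ‖h‖ ^ 2 ∧
      P.map (fun ω => W t h ω - W s h ω) = gaussianReal 0 v := by
  lift s to ℝ≥0 using hs
  lift t to ℝ≥0 using s.2.trans hst
  refine ⟨(t - s) * ‖h‖₊ ^ 2, ?_, hW.increment_law s t h hst⟩
  rw [NNReal.coe_mul, NNReal.coe_sub (by exact_mod_cast hst)]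
  simp

theorem IsCylindricalWiener.memLp_increment (hW : IsCylindricalWiener P 𝓕 W) {s t : ℝ}
    (hs : 0 ≤ s) (hst : s ≤ t) (h : H) : MemLp (fun ω => W t h ω - W s h ω) 2 P := by
  obtain ⟨v, -, hv⟩ := hW.map_increment hs hst h
  have hm : Measurable (fun ω => W t h ω - W s h ω) :=
    (hW.measurable (hs.trans hst) h).sub (hW.measurable hs h)
  have := memLp_id_gaussianReal' (μ := 0) (v := v) 2 (by simp)
  rw [← hv, memLp_map_measure_iff (by fun_prop) hm.aemeasurable] at this
  exact this

theorem IsCylindricalWiener.integral_increment (hW : IsCylindricalWiener P 𝓕 W) {s t : ℝ}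
    (hs : 0 ≤ s) (hst : s ≤ t) (h : H) : ∫ ω, (W t h ω - W s h ω) ∂P = 0 := by
  obtain ⟨v, -, hv⟩ := hW.map_increment hs hst h
  have hm : Measurable (fun ω => W t h ω - W s h ω) :=
    (hW.measurable (hs.trans hst) h).sub (hW.measurable hs h)
  have := integral_id_gaussianReal (μ := 0) (v := v)
  rw [← hv, integral_map hm.aemeasurable (by fun_prop)] at this
  exact this

theorem IsCylindricalWiener.integral_increment_sq (hW : IsCylindricalWiener P 𝓕 W) {s t : ℝ}
    (hs : 0 ≤ s) (hst : s ≤ t) (h : H) :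
    ∫ ω, (W t h ω - W s h ω) ^ 2 ∂P = (t - s) * ‖h‖ ^ 2 := by
  obtain ⟨v, hv', hv⟩ := hW.map_increment hs hst h
  have hm : Measurable (fun ω => W t h ω - W s h ω) :=
    (hW.measurable (hs.trans hst) h).sub (hW.measurable hs h)
  have h1 := variance_id_gaussianReal (μ := 0) (v := v)
  rw [variance_of_integral_eq_zero (by fun_prop) (by simp)] at h1
  rw [← hv, integral_map hm.aemeasurable (by fun_prop)] at h1
  rw [← hv', ← h1]
  rfl

theorem IsCylindricalWiener.memLp (hW : IsCylindricalWiener P 𝓕 W) {t : ℝ} (ht : 0 ≤ t) (h : H) :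
    MemLp (W t h) 2 P := by
  refine (hW.memLp_increment le_rfl ht h).ae_eq ?_
  filter_upwards [hW.zero h] with ω hω
  rw [hω, sub_zero]

theorem IsCylindricalWiener.integral_sq (hW : IsCylindricalWiener P 𝓕 W) {t : ℝ} (ht : 0 ≤ t)
    (h : H) : ∫ ω, W t h ω ^ 2 ∂P = t * ‖h‖ ^ 2 := by
  rw [← sub_zero t, ← hW.integral_increment_sq le_rfl ht h, sub_zero]
  refine integral_congr_ae ?_
  filter_upwards [hW.zero h] with ω hω
  rw [hω, sub_zero]

theorem IsCylindricalWiener.integral_mul_same (hW : IsCylindricalWiener P 𝓕 W) {t : ℝ}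
    (ht : 0 ≤ t) (h k : H) : ∫ ω, W t h ω * W t k ω ∂P = t * inner ℝ h k := by
  have hi : ∀ u, Integrable (fun ω => W t u ω ^ 2) P := fun u => (hW.memLp ht u).integrable_sq
  have h1 : (fun ω => W t h ω * W t k ω) =ᵐ[P]
      fun ω => (1 / 2) * (W t (h + k) ω ^ 2 - W t h ω ^ 2 - W t k ω ^ 2) := by
    filter_upwards [hW.linear t ht 1 1 h k] with ω hω
    simp only [one_smul, one_mul] at hω
    rw [hω]; ring
  have hi2 : Integrable (fun ω => W t (h + k) ω ^ 2 - W t h ω ^ 2) P := (hi _).sub (hi _)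
  rw [integral_congr_ae h1, integral_const_mul, integral_sub hi2 (hi _),
    integral_sub (hi _) (hi _), hW.integral_sq ht, hW.integral_sq ht, hW.integral_sq ht,
    norm_add_sq_real]
  ring

theorem IsCylindricalWiener.integral_mul_increment (hW : IsCylindricalWiener P 𝓕 W)
    {s t : ℝ} (hs : 0 ≤ s) (hst : s ≤ t) (h k : H) :
    ∫ ω, W s h ω * (W t k ω - W s k ω) ∂P = 0 := by
  have hind : IndepFun (W s h) (fun ω => W t k ω - W s k ω) P := by
    rw [IndepFun_iff_Indep]
    refine indep_of_indep_of_le_left (hW.increment_indep ⟨s, hs⟩ ⟨t, hs.trans hst⟩ k hst) ?_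
    exact (hW.adapted ⟨s, hs⟩ h).measurable.comap_le
  rw [hind.integral_fun_mul_eq_mul_integral (hW.measurable hs h).aestronglyMeasurable
    ((hW.measurable (hs.trans hst) k).sub (hW.measurable hs k)).aestronglyMeasurable,
    hW.integral_increment hs hst, mul_zero]

theorem IsCylindricalWiener.covariance_of_le (hW : IsCylindricalWiener P 𝓕 W) {s t : ℝ}
    (hs : 0 ≤ s) (hst : s ≤ t) (h k : H) : ∫ ω, W s h ω * W t k ω ∂P = s * inner ℝ h k := by
  have h1 : (fun ω => W s h ω * W t k ω)
      = fun ω => W s h ω * W s k ω + W s h ω * (W t k ω - W s k ω) := by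
    funext ω; ring
  have hi1 : Integrable (fun ω => W s h ω * W s k ω) P :=
    (hW.memLp hs h).integrable_mul (hW.memLp hs k)
  have hi2 : Integrable (fun ω => W s h ω * (W t k ω - W s k ω)) P :=
    (hW.memLp hs h).integrable_mul (hW.memLp_increment hs hst k)
  rw [h1, integral_add hi1 hi2, hW.integral_mul_same hs,
    hW.integral_mul_increment hs hst, add_zero]

theorem IsCylindricalWiener.covariance (hW : IsCylindricalWiener P 𝓕 W) {s t : ℝ}
    (hs : 0 ≤ s) (ht : 0 ≤ t) (h k : H) :
    ∫ ω, W s h ω * W t k ω ∂P = min s t * inner ℝ h k := by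
  rcases le_total s t with hst | hst
  · rw [min_eq_left hst, hW.covariance_of_le hs hst]
  · rw [min_eq_right hst, real_inner_comm, ← hW.covariance_of_le ht hst]
    simp_rw [mul_comm]

end Covariance

/-! ### The Itô isometry for vector-valued step functions -/

section Isometry

variable {H : Type*} [NormedAddCommGroup H] [InnerProductSpace ℝ H]
variable {Ω : Type*} {mΩ : MeasurableSpace Ω} {P : Measure Ω} {𝓕 : Filtration ℝ≥0 mΩ}
  {W : ℝ → H → Ω → ℝ}

/-- The `H`-valued step function `∑ᵢ 1_{(aᵢ, bᵢ]} cᵢ hᵢ`. The scalars `cᵢ` are kept apart from the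
vectors `hᵢ` because `h ↦ W t h` is linear only up to null sets. -/
noncomputable def stepFun {κ : Type*} [Fintype κ] (a b c : κ → ℝ) (h : κ → H) (s : ℝ) : H :=
  ∑ i, (Ioc (a i) (b i)).indicator (fun _ => c i • h i) s

/-- The Wiener integral `∑ᵢ cᵢ (W(bᵢ) hᵢ - W(aᵢ) hᵢ)` of a step function. -/
noncomputable def stepIntegral {κ : Type*} [Fintype κ] (W : ℝ → H → Ω → ℝ) (a b c : κ → ℝ)
    (h : κ → H) (ω : Ω) : ℝ :=
  ∑ i, c i * (W (b i) (h i) ω - W (a i) (h i) ω)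

theorem measureReal_Ioc_inter_Ioc {a b c d : ℝ} (hab : a ≤ b) (hcd : c ≤ d) :
    volume.real (Ioc a b ∩ Ioc c d) = min b d - min b c - min a d + min a c := by
  rw [Ioc_inter_Ioc, Measure.real, Real.volume_Ioc, ENNReal.toReal_ofReal']
  simp only [max_def, min_def]
  split_ifs <;> linarith

theorem IsCylindricalWiener.integral_increment_mul_increment (hW : IsCylindricalWiener P 𝓕 W)
    {a b c d : ℝ} (ha : 0 ≤ a) (hab : a ≤ b) (hc : 0 ≤ c) (hcd : c ≤ d) (h k : H) :
    ∫ ω, (W b h ω - W a h ω) * (W d k ω - W c k ω) ∂P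
      = volume.real (Ioc a b ∩ Ioc c d) * inner ℝ h k := by
  have hb := ha.trans hab
  have hd := hc.trans hcd
  have hi : ∀ {s t : ℝ}, 0 ≤ s → 0 ≤ t → Integrable (fun ω => W s h ω * W t k ω) P :=
    fun hs ht => (hW.memLp hs h).integrable_mul (hW.memLp ht k)
  have h1 : (fun ω => (W b h ω - W a h ω) * (W d k ω - W c k ω))
      = fun ω => W b h ω * W d k ω - W b h ω * W c k ω - W a h ω * W d k ω
        + W a h ω * W c k ω := by
    funext ω; ring
  have hi1 : Integrable (fun ω => W b h ω * W d k ω - W b h ω * W c k ω) P :=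
    (hi hb hd).sub (hi hb hc)
  have hi2 : Integrable (fun ω => W b h ω * W d k ω - W b h ω * W c k ω - W a h ω * W d k ω) P :=
    hi1.sub (hi ha hd)
  rw [h1, integral_add hi2 (hi ha hc), integral_sub hi1 (hi ha hd), integral_sub (hi hb hd) (hi hb hc),
    hW.covariance hb hd, hW.covariance hb hc, hW.covariance ha hd, hW.covariance ha hc,
    measureReal_Ioc_inter_Ioc hab hcd]
  ring

variable {κ : Type*} [Fintype κ] {a b c : κ → ℝ} {h : κ → H} {t : ℝ}

theorem norm_sq_stepFun (a b c : κ → ℝ) (h : κ → H) (s : ℝ) :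
    ‖stepFun a b c h s‖ ^ 2 = ∑ i, ∑ j, (Ioc (a i) (b i) ∩ Ioc (a j) (b j)).indicator
      (fun _ => c i * c j * inner ℝ (h i) (h j)) s := by
  rw [← real_inner_self_eq_norm_sq, stepFun, sum_inner]
  refine Finset.sum_congr rfl fun i _ => ?_
  rw [inner_sum]
  refine Finset.sum_congr rfl fun j _ => ?_
  by_cases hi : s ∈ Ioc (a i) (b i) <;> by_cases hj : s ∈ Ioc (a j) (b j) <;>
    simp only [indicator_of_mem, indicator_of_notMem, mem_inter_iff, hi, hj, not_false_eq_true,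
      inner_zero_left, inner_zero_right, and_true, and_false, inner_smul_left, inner_smul_right,
      conj_trivial, mul_zero]
  ring

theorem IsCylindricalWiener.memLp_stepIntegral (hW : IsCylindricalWiener P 𝓕 W)
    (ha : ∀ i, 0 ≤ a i) (hab : ∀ i, a i ≤ b i) : MemLp (stepIntegral W a b c h) 2 P := by
  have := memLp_finsetSum (μ := P) (p := 2) Finset.univ
    (f := fun i ω => c i * (W (b i) (h i) ω - W (a i) (h i) ω))
    fun i _ => (hW.memLp_increment (ha i) (hab i) (h i)).const_mul (c i)
  exact this

/-- Both sides are quadratic forms in `c`, with the same coefficients by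
`integral_increment_mul_increment`. -/
theorem IsCylindricalWiener.integral_stepIntegral_sq (hW : IsCylindricalWiener P 𝓕 W)
    (ha : ∀ i, 0 ≤ a i) (hab : ∀ i, a i ≤ b i) (hb : ∀ i, b i ≤ t) :
    Integrable (fun s => ‖stepFun a b c h s‖ ^ 2) (volume.restrict (Ioc 0 t)) ∧
    ∫ ω, stepIntegral W a b c h ω ^ 2 ∂P = ∫ s in Ioc 0 t, ‖stepFun a b c h s‖ ^ 2 := by
  have hint : ∀ i j, Integrable (fun s => (Ioc (a i) (b i) ∩ Ioc (a j) (b j)).indicator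
      (fun _ => c i * c j * inner ℝ (h i) (h j)) s) (volume.restrict (Ioc 0 t)) := fun i j =>
    (integrable_const _).indicator (measurableSet_Ioc.inter measurableSet_Ioc)
  simp_rw [norm_sq_stepFun]
  refine ⟨integrable_finsetSum _ fun i _ => integrable_finsetSum _ fun j _ => hint i j, ?_⟩
  rw [integral_finsetSum _ fun i _ => integrable_finsetSum _ fun j _ => hint i j]
  have h1 : ∀ ω, stepIntegral W a b c h ω ^ 2 = ∑ i, ∑ j, c i * c j *
      ((W (b i) (h i) ω - W (a i) (h i) ω) * (W (b j) (h j) ω - W (a j) (h j) ω)) := by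
    intro ω
    rw [sq, stepIntegral, Finset.sum_mul_sum]
    refine Finset.sum_congr rfl fun i _ => Finset.sum_congr rfl fun j _ => by ring
  simp_rw [h1]
  have hi2 : ∀ i j, Integrable (fun ω => c i * c j *
      ((W (b i) (h i) ω - W (a i) (h i) ω) * (W (b j) (h j) ω - W (a j) (h j) ω))) P := fun i j =>
    ((hW.memLp_increment (ha i) (hab i) (h i)).integrable_mul
      (hW.memLp_increment (ha j) (hab j) (h j))).const_mul _
  rw [integral_finsetSum _ fun i _ => integrable_finsetSum _ fun j _ => hi2 i j]
  refine Finset.sum_congr rfl fun i _ => ?_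
  rw [integral_finsetSum _ fun j _ => hi2 i j, integral_finsetSum _ fun j _ => hint i j]
  refine Finset.sum_congr rfl fun j _ => ?_
  rw [integral_const_mul, hW.integral_increment_mul_increment (ha i) (hab i) (ha j) (hab j),
    integral_indicator_const _ (measurableSet_Ioc.inter measurableSet_Ioc),
    measureReal_restrict_apply (measurableSet_Ioc.inter measurableSet_Ioc),
    inter_eq_left.2 (inter_subset_left.trans (Ioc_subset_Ioc (ha i) (hb i))), smul_eq_mul]
  ring

theorem ofReal_norm_sq {E : Type*} [SeminormedAddCommGroup E] (x : E) :
    ENNReal.ofReal (‖x‖ ^ 2) = ‖x‖ₑ ^ 2 := by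
  rw [ENNReal.ofReal_pow (norm_nonneg _), ofReal_norm]

theorem IsCylindricalWiener.lintegral_stepIntegral_sq (hW : IsCylindricalWiener P 𝓕 W)
    (ha : ∀ i, 0 ≤ a i) (hab : ∀ i, a i ≤ b i) (hb : ∀ i, b i ≤ t) :
    ∫⁻ ω, ‖stepIntegral W a b c h ω‖ₑ ^ 2 ∂P = ∫⁻ s in Ioc 0 t, ‖stepFun a b c h s‖ₑ ^ 2 := by
  obtain ⟨h1, h2⟩ := hW.integral_stepIntegral_sq (c := c) (h := h) ha hab hb
  have h3 : Integrable (fun ω => stepIntegral W a b c h ω ^ 2) P :=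
    (hW.memLp_stepIntegral ha hab).integrable_sq
  simp_rw [← ofReal_norm_sq]
  rw [← ofReal_integral_eq_lintegral_ofReal h1 (ae_of_all _ fun _ => sq_nonneg _), ← h2]
  simp_rw [Real.norm_eq_abs, sq_abs]
  rw [← ofReal_integral_eq_lintegral_ofReal h3 (ae_of_all _ fun _ => sq_nonneg _)]

variable {κ' : Type*} [Fintype κ'] {a' b' c' : κ' → ℝ} {h' : κ' → H}

/-- The isometry for the difference of two step functions. -/
theorem IsCylindricalWiener.lintegral_stepIntegral_sub_sq (hW : IsCylindricalWiener P 𝓕 W)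
    (ha : ∀ i, 0 ≤ a i) (hab : ∀ i, a i ≤ b i) (hb : ∀ i, b i ≤ t)
    (ha' : ∀ i, 0 ≤ a' i) (hab' : ∀ i, a' i ≤ b' i) (hb' : ∀ i, b' i ≤ t) :
    ∫⁻ ω, ‖stepIntegral W a b c h ω - stepIntegral W a' b' c' h' ω‖ₑ ^ 2 ∂P
      = ∫⁻ s in Ioc 0 t, ‖stepFun a b c h s - stepFun a' b' c' h' s‖ₑ ^ 2 := by
  have := hW.lintegral_stepIntegral_sq (a := Sum.elim a a') (b := Sum.elim b b')
    (c := Sum.elim c (fun i => - c' i)) (h := Sum.elim h h') (t := t)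
    (by rintro (i | i) <;> simp [ha, ha']) (by rintro (i | i) <;> simp [hab, hab'])
    (by rintro (i | i) <;> simp [hb, hb'])
  convert! this using 3 with ω s
  · simp [stepIntegral, sub_eq_add_neg]
  · simp only [stepFun, Fintype.sum_sum_type, Sum.elim_inl, Sum.elim_inr, sub_eq_add_neg]
    congr 3
    rw [← Finset.sum_neg_distrib]
    refine Finset.sum_congr rfl fun i _ => ?_
    by_cases hi : s ∈ Ioc (a' i) (b' i) <;> simp [hi]

end Isometry

/-! ### The scalar Ornstein-Uhlenbeck functional and its Riemann sums -/

section Riemann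

/-- The solution `u(t) = w(t) - lam ∫₀ᵗ exp (-lam (t - s)) w(s) ds` of the integral equation
`u(t) = w(t) - lam ∫₀ᵗ u(s) ds`. It is the integrated-by-parts form of
`∫₀ᵗ exp (-lam (t - s)) dw(s)` when `w(0) = 0`, and makes sense for every continuous `w`. -/
noncomputable def ouPath (lam : ℝ) (w : ℝ → ℝ) (t : ℝ) : ℝ :=
  w t - lam * ∫ s in (0 : ℝ)..t, Real.exp (-lam * (t - s)) * w s

/-- The points `t j / (m + 1)` of the uniform grid on `[0, t]`. -/
noncomputable def gridPoint (t : ℝ) (m j : ℕ) : ℝ := t * j / (m + 1)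

theorem gridPoint_zero (t : ℝ) (m : ℕ) : gridPoint t m 0 = 0 := by simp [gridPoint]

theorem gridPoint_last (t : ℝ) (m : ℕ) : gridPoint t m (m + 1) = t := by
  have : (m : ℝ) + 1 ≠ 0 := by positivity
  simp [gridPoint, this]

theorem gridPoint_mono {t : ℝ} (ht : 0 ≤ t) (m : ℕ) : Monotone (gridPoint t m) := by
  intro i j hij
  unfold gridPoint
  gcongr

theorem gridPoint_nonneg {t : ℝ} (ht : 0 ≤ t) (m j : ℕ) : 0 ≤ gridPoint t m j := by
  unfold gridPoint; positivity

theorem gridPoint_le {t : ℝ} (ht : 0 ≤ t) {m j : ℕ} (hj : j ≤ m + 1) : gridPoint t m j ≤ t := by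
  have := gridPoint_mono ht m hj
  rwa [gridPoint_last] at this

theorem gridPoint_succ_sub (t : ℝ) (m j : ℕ) :
    gridPoint t m (j + 1) - gridPoint t m j = t / (m + 1) := by
  unfold gridPoint; push_cast; ring

/-- The value at the left end point of the grid interval of the function `s ↦ exp (-lam (t - s))`. -/
noncomputable def gridWeight (lam t : ℝ) (m j : ℕ) : ℝ := Real.exp (-lam * (t - gridPoint t m j))

/-- The step function on the grid approximating `s ↦ exp (-lam (t - s))` by its values at the left
end points. -/
noncomputable def gridExp (lam t : ℝ) (m : ℕ) (s : ℝ) : ℝ :=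
  ∑ j : Fin (m + 1), (Ioc (gridPoint t m j) (gridPoint t m (j + 1))).indicator
    (fun _ => gridWeight lam t m j) s

theorem measurable_gridExp (lam t : ℝ) (m : ℕ) : Measurable (gridExp lam t m) :=
  Finset.measurable_sum _ fun _ _ => measurable_const.indicator measurableSet_Ioc

theorem exists_gridExp_eq {lam t : ℝ} (m : ℕ) {s : ℝ} (hs : s ∈ Ioc 0 t) :
    ∃ r, 0 ≤ r ∧ r ≤ s ∧ s - r ≤ t / (m + 1) ∧ gridExp lam t m s = Real.exp (-lam * (t - r)) := by
  have ht : 0 < t := hs.1.trans_le hs.2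
  have hm : (0 : ℝ) < m + 1 := by positivity
  have hpos : 0 < s * (m + 1) / t := div_pos (mul_pos hs.1 hm) ht
  have hc : 0 < ⌈s * (m + 1) / t⌉₊ := Nat.ceil_pos.2 hpos
  obtain ⟨j, hj⟩ : ∃ j, ⌈s * (m + 1) / t⌉₊ = j + 1 := ⟨_, (Nat.succ_pred_eq_of_pos hc).symm⟩
  have h1 := Nat.lt_ceil (a := s * (m + 1) / t) (n := j)
  have h2 := Nat.le_ceil (s * (m + 1) / t)
  rw [hj] at h1 h2
  have hlt : (j : ℝ) < s * (m + 1) / t := h1.1 (Nat.lt_succ_self j)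
  have hjm : j < m + 1 := by
    have : s * (m + 1) / t ≤ m + 1 := by
      rw [div_le_iff₀ ht]; nlinarith [hs.2]
    have : (j : ℝ) < (m + 1 : ℕ) := by push_cast; linarith
    exact_mod_cast this
  have hmem : s ∈ Ioc (gridPoint t m j) (gridPoint t m (j + 1)) := by
    unfold gridPoint
    rw [lt_div_iff₀ ht] at hlt
    push_cast at h2
    rw [div_le_iff₀ ht] at h2
    constructor
    · rw [div_lt_iff₀ hm]; linarith
    · push_cast; rw [le_div_iff₀ hm]; linarith
  refine ⟨gridPoint t m j, gridPoint_nonneg ht.le m j, hmem.1.le, ?_, ?_⟩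
  · rw [← gridPoint_succ_sub t m j]; linarith [hmem.2]
  · unfold gridExp
    rw [Finset.sum_eq_single ⟨j, hjm⟩]
    · rw [indicator_of_mem hmem]; rfl
    · intro i _ hij
      refine indicator_of_notMem (fun hi => hij ?_) _
      have hij' : (i : ℕ) = j := by
        by_contra hne
        rcases lt_or_gt_of_ne hne with hlt | hlt
        · have := gridPoint_mono ht.le m (show (i : ℕ) + 1 ≤ j by omega)
          linarith [hi.2, hmem.1]
        · have := gridPoint_mono ht.le m (show j + 1 ≤ (i : ℕ) by omega)
          linarith [hi.1, hmem.2]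
      exact Fin.ext hij'
    · simp

theorem gridExp_mem_Icc {lam t : ℝ} (hlam : 0 ≤ lam) (m : ℕ) {s : ℝ} (hs : s ∈ Ioc 0 t) :
    gridExp lam t m s ∈ Icc 0 (Real.exp (-lam * (t - s))) := by
  obtain ⟨r, -, hr, -, h⟩ := exists_gridExp_eq (lam := lam) m hs
  rw [h]
  exact ⟨Real.exp_nonneg _, Real.exp_le_exp.2 (by nlinarith)⟩

theorem abs_gridExp_le {lam t : ℝ} (m : ℕ) {s : ℝ} (hs : s ∈ Ioc 0 t) :
    |gridExp lam t m s| ≤ Real.exp (|lam| * t) := by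
  obtain ⟨r, hr0, hr, -, h⟩ := exists_gridExp_eq (lam := lam) m hs
  rw [h, abs_of_nonneg (Real.exp_nonneg _), Real.exp_le_exp]
  have h1 : 0 ≤ t - r := by linarith [hs.2]
  calc -lam * (t - r) ≤ |lam| * (t - r) := by gcongr; exact neg_le_abs lam
    _ ≤ |lam| * t := by gcongr; linarith

theorem tendsto_gridExp {lam t s : ℝ} (hs : s ∈ Ioc 0 t) :
    Tendsto (fun m => gridExp lam t m s) atTop (𝓝 (Real.exp (-lam * (t - s)))) := by
  choose r _ hr hr' hE using fun m => exists_gridExp_eq (lam := lam) m hs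
  have h0 : Tendsto (fun m : ℕ => t / ((m : ℝ) + 1)) atTop (𝓝 0) :=
    tendsto_const_div_atTop_nhds_zero_nat t |>.comp (tendsto_add_atTop_nat 1) |>.congr
      fun m => by simp
  have h1 : Tendsto r atTop (𝓝 s) := by
    have h2 : Tendsto (fun m : ℕ => s - t / ((m : ℝ) + 1)) atTop (𝓝 s) := by
      simpa using tendsto_const_nhds.sub h0
    exact tendsto_of_tendsto_of_tendsto_of_le_of_le h2 tendsto_const_nhds
      (fun m => by linarith [hr' m]) hr
  simp_rw [hE]
  exact ((by fun_prop : Continuous fun r => Real.exp (-lam * (t - r))).tendsto s).comp h1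

/-- The Riemann-Stieltjes sums of `exp (-lam (t - s))` against a continuous path `w` converge,
whether or not `w` has bounded variation: summation by parts moves the increments to the
exponential. -/
theorem tendsto_riemannSum {lam t : ℝ} (ht : 0 ≤ t) {w : ℝ → ℝ} (hw : ContinuousOn w (Icc 0 t))
    (hw0 : w 0 = 0) :
    Tendsto (fun m : ℕ => ∑ j : Fin (m + 1),
      gridWeight lam t m j * (w (gridPoint t m (j + 1)) - w (gridPoint t m j)))
      atTop (𝓝 (ouPath lam w t)) := by
  set ρ : ℝ → ℝ := fun s => Real.exp (-lam * (t - s)) with hρ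
  have hρc : Continuous ρ := by fun_prop
  have hρd : ∀ s, HasDerivAt ρ (lam * ρ s) s := fun s => by
    have h1 : HasDerivAt (fun s => -lam * (t - s)) lam s := by
      simpa using ((hasDerivAt_id s).const_sub t).const_mul (-lam)
    simpa [hρ, mul_comm] using h1.exp
  set C : ℝ := |lam| * Real.exp (|lam| * t) with hC
  have hC0 : 0 ≤ C := by positivity
  have hbound : ∀ s ∈ Icc 0 t, |lam * ρ s| ≤ C := fun s hs => by
    rw [abs_mul, hC, abs_of_nonneg (Real.exp_nonneg _ : 0 ≤ ρ s)]
    refine mul_le_mul_of_nonneg_left (Real.exp_le_exp.2 ?_) (abs_nonneg _)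
    have h1 : 0 ≤ t - s := by linarith [hs.2]
    calc -lam * (t - s) ≤ |lam| * (t - s) := by gcongr; exact neg_le_abs lam
      _ ≤ |lam| * t := by gcongr; linarith [hs.1]
  have huc := isCompact_Icc.uniformContinuousOn_of_continuous hw
  rw [Metric.uniformContinuousOn_iff] at huc
  rw [Metric.tendsto_atTop]
  intro ε hε
  obtain ⟨δ, hδ, huc⟩ := huc (ε / (C * t + 1)) (by positivity)
  have h0 : Tendsto (fun m : ℕ => t / ((m : ℝ) + 1)) atTop (𝓝 0) :=
    tendsto_const_div_atTop_nhds_zero_nat t |>.comp (tendsto_add_atTop_nat 1) |>.congr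
      fun m => by simp
  obtain ⟨N, hN⟩ := (h0.eventually (gt_mem_nhds hδ)).exists_forall_of_atTop
  refine ⟨N, fun m hm => ?_⟩
  have hmesh := hN m hm
  set x := gridPoint t m with hx
  have hxmem : ∀ j, j ≤ m + 1 → x j ∈ Icc 0 t := fun j hj =>
    ⟨gridPoint_nonneg ht m j, gridPoint_le ht hj⟩
  have hxle : ∀ j, x j ≤ x (j + 1) := fun j => gridPoint_mono ht m (Nat.le_succ j)
  have hsub : ∀ j < m + 1, Icc (x j) (x (j + 1)) ⊆ Icc 0 t := fun j hj =>
    Icc_subset_Icc (hxmem j (by omega)).1 (hxmem (j + 1) (by omega)).2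
  have hii : ∀ j < m + 1, IntervalIntegrable (fun s => ρ s * w s) volume (x j) (x (j + 1)) :=
    fun j hj => by
      refine ContinuousOn.intervalIntegrable ?_
      rw [uIcc_of_le (hxle j)]
      exact hρc.continuousOn.mul (hw.mono (hsub j hj))
  -- The error on one grid interval, after summation by parts.
  have hstep : ∀ j < m + 1, ρ (x j) * (w (x (j + 1)) - w (x j))
      - ((ρ (x (j + 1)) * w (x (j + 1)) - ρ (x j) * w (x j))
        - lam * ∫ s in x j..x (j + 1), ρ s * w s)
      = ∫ s in x j..x (j + 1), lam * ρ s * (w s - w (x (j + 1))) := fun j hj => by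
    have h1 : ∫ s in x j..x (j + 1), lam * ρ s = ρ (x (j + 1)) - ρ (x j) :=
      intervalIntegral.integral_eq_sub_of_hasDerivAt (fun s _ => hρd s)
        ((continuous_const.mul hρc).intervalIntegrable _ _)
    have h2 : ∀ s, lam * ρ s * (w s - w (x (j + 1)))
        = lam * (ρ s * w s) - lam * ρ s * w (x (j + 1)) := fun s => by ring
    have hi : IntervalIntegrable (fun s => lam * ρ s * w (x (j + 1))) volume (x j) (x (j + 1)) :=
      ((continuous_const.mul hρc).mul continuous_const).intervalIntegrable _ _
    simp_rw [h2]
    rw [intervalIntegral.integral_sub ((hii j hj).const_mul lam) hi,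
      intervalIntegral.integral_const_mul, intervalIntegral.integral_mul_const, h1]
    ring
  have hle : ∀ j < m + 1, |∫ s in x j..x (j + 1), lam * ρ s * (w s - w (x (j + 1)))|
      ≤ C * (ε / (C * t + 1)) * (t / (m + 1)) := fun j hj => by
    have := intervalIntegral.norm_integral_le_of_norm_le_const (a := x j) (b := x (j + 1))
      (f := fun s => lam * ρ s * (w s - w (x (j + 1)))) (C := C * (ε / (C * t + 1)))
      (fun s hs => by
        rw [uIoc_of_le (hxle j)] at hs
        have hs' := hsub j hj (Ioc_subset_Icc_self hs)
        rw [norm_mul, Real.norm_eq_abs]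
        gcongr
        · exact hbound s hs'
        · refine (huc s hs' _ (hxmem (j + 1) (by omega)) ?_).le
          rw [Real.dist_eq, abs_sub_comm, abs_of_nonneg (by linarith [hs.2])]
          have := gridPoint_succ_sub t m j
          rw [← hx] at this
          linarith [hs.1])
    rwa [Real.norm_eq_abs, gridPoint_succ_sub, abs_of_nonneg (a := t / ((m : ℝ) + 1)) (by positivity)] at this
  have htel : ∑ j ∈ Finset.range (m + 1), (ρ (x (j + 1)) * w (x (j + 1)) - ρ (x j) * w (x j))
      = w t := by
    rw [Finset.sum_range_sub (fun j => ρ (x j) * w (x j))]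
    simp [hx, gridPoint_zero, gridPoint_last, hw0, hρ]
  have hint : ∑ j ∈ Finset.range (m + 1), ∫ s in x j..x (j + 1), ρ s * w s
      = ∫ s in (0 : ℝ)..t, ρ s * w s := by
    rw [intervalIntegral.sum_integral_adjacent_intervals hii, hx, gridPoint_zero, gridPoint_last]
  rw [Fin.sum_univ_eq_sum_range (fun j => gridWeight lam t m j *
    (w (gridPoint t m (j + 1)) - w (gridPoint t m j)))]
  have herr : ∑ j ∈ Finset.range (m + 1), ρ (x j) * (w (x (j + 1)) - w (x j)) - ouPath lam w t
      = ∑ j ∈ Finset.range (m + 1), ∫ s in x j..x (j + 1), lam * ρ s * (w s - w (x (j + 1))) := by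
    rw [← Finset.sum_congr rfl (fun j hj => hstep j (Finset.mem_range.1 hj)),
      Finset.sum_sub_distrib, Finset.sum_sub_distrib, htel, ← Finset.mul_sum, hint]
    rfl
  change dist (∑ j ∈ Finset.range (m + 1), ρ (x j) * (w (x (j + 1)) - w (x j))) _ < ε
  rw [Real.dist_eq, herr]
  calc _ ≤ ∑ j ∈ Finset.range (m + 1), C * (ε / (C * t + 1)) * (t / (m + 1)) :=
        (Finset.abs_sum_le_sum_abs _ _).trans
          (Finset.sum_le_sum fun j hj => hle j (Finset.mem_range.1 hj))
    _ = ε * (C * t / (C * t + 1)) := by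
        rw [Finset.sum_const, Finset.card_range, nsmul_eq_mul]
        push_cast
        field_simp
    _ < ε * 1 := by
        gcongr
        rw [div_lt_one (by positivity)]
        linarith
    _ = ε := mul_one ε

end Riemann

/-! ### Mean square approximation of the scalar Ornstein-Uhlenbeck functional -/

section MeanSquare

variable {H : Type*} [NormedAddCommGroup H] [InnerProductSpace ℝ H]
variable {Ω : Type*} {mΩ : MeasurableSpace Ω} {P : Measure Ω} {𝓕 : Filtration ℝ≥0 mΩ}
  {W : ℝ → H → Ω → ℝ}

theorem stronglyMeasurable_stepFun {κ : Type*} [Fintype κ] (a b c : κ → ℝ) (h : κ → H) :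
    StronglyMeasurable (stepFun a b c h) :=
  Finset.stronglyMeasurable_fun_sum _ fun _ _ =>
    stronglyMeasurable_const.indicator measurableSet_Ioc

theorem stepFun_grid (lam t : ℝ) (m : ℕ) (e : H) (s : ℝ) :
    stepFun (fun j : Fin (m + 1) => gridPoint t m j) (fun j => gridPoint t m (j + 1))
      (fun j => gridWeight lam t m j) (fun _ => e) s = gridExp lam t m s • e := by
  unfold stepFun gridExp
  rw [Finset.sum_smul]
  refine Finset.sum_congr rfl fun j _ => ?_
  by_cases hj : s ∈ Ioc (gridPoint t m j) (gridPoint t m (j + 1)) <;> simp [hj]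

theorem norm_stepFun_le {κ : Type*} [Fintype κ] (a b c : κ → ℝ) (h : κ → H) (s : ℝ) :
    ‖stepFun a b c h s‖ ≤ ∑ i, ‖c i • h i‖ :=
  (norm_sum_le _ _).trans (Finset.sum_le_sum fun _ _ => norm_indicator_le_norm_self _ _)

theorem IsCylindricalWiener.tendsto_stepIntegral_grid (hW : IsCylindricalWiener P 𝓕 W) {t : ℝ}
    (ht : 0 ≤ t) (lam : ℝ) (e : H) :
    ∀ᵐ ω ∂P, Tendsto (fun m : ℕ => stepIntegral W (fun j : Fin (m + 1) => gridPoint t m j)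
      (fun j => gridPoint t m (j + 1)) (fun j => gridWeight lam t m j) (fun _ => e) ω)
      atTop (𝓝 (ouPath lam (fun s => W s e ω) t)) := by
  filter_upwards [hW.zero e, hW.continuous e] with ω h0 hc
  exact tendsto_riemannSum ht (hc.mono Icc_subset_Ici_self) h0

theorem IsCylindricalWiener.measurable_stepIntegral (hW : IsCylindricalWiener P 𝓕 W)
    {κ : Type*} [Fintype κ] {a b c : κ → ℝ} {h : κ → H}
    (ha : ∀ i, 0 ≤ a i) (hab : ∀ i, a i ≤ b i) : Measurable (stepIntegral W a b c h) :=
  Finset.measurable_sum _ fun i _ =>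
    ((hW.measurable ((ha i).trans (hab i)) _).sub (hW.measurable (ha i) _)).const_mul _

theorem IsCylindricalWiener.aemeasurable_ouPath (hW : IsCylindricalWiener P 𝓕 W) {t : ℝ}
    (ht : 0 ≤ t) (lam : ℝ) (e : H) :
    AEMeasurable (fun ω => ouPath lam (fun s => W s e ω) t) P :=
  aemeasurable_of_tendsto_metrizable_ae atTop
    (fun m => (hW.measurable_stepIntegral (fun _ => gridPoint_nonneg ht m _)
      (fun _ => gridPoint_mono ht m (Nat.le_succ _))).aemeasurable)
    (hW.tendsto_stepIntegral_grid ht lam e)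

/-- One half of the Itô isometry for `∫₀ᵗ exp (-lam (t - s)) ⟨e, dW(s)⟩`, by Fatou's lemma. -/
theorem IsCylindricalWiener.lintegral_stepIntegral_sub_ouPath_le (hW : IsCylindricalWiener P 𝓕 W)
    {κ : Type*} [Fintype κ] {a b c : κ → ℝ} {h : κ → H} {t : ℝ} (ht : 0 ≤ t)
    (ha : ∀ i, 0 ≤ a i) (hab : ∀ i, a i ≤ b i) (hb : ∀ i, b i ≤ t) (lam : ℝ) (e : H) :
    ∫⁻ ω, ‖stepIntegral W a b c h ω - ouPath lam (fun s => W s e ω) t‖ₑ ^ 2 ∂P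
      ≤ ∫⁻ s in Ioc 0 t, ‖stepFun a b c h s - Real.exp (-lam * (t - s)) • e‖ₑ ^ 2 := by
  have hlim := hW.tendsto_stepIntegral_grid ht lam e
  set J : ℕ → Ω → ℝ := fun m => stepIntegral W (fun j : Fin (m + 1) => gridPoint t m j)
      (fun j => gridPoint t m (j + 1)) (fun j => gridWeight lam t m j) (fun _ => e) with hJ
  have hJm : ∀ m, Measurable (J m) := fun m =>
    hW.measurable_stepIntegral (fun _ => gridPoint_nonneg ht m _)
      (fun _ => gridPoint_mono ht m (Nat.le_succ _))
  have hIm : Measurable (stepIntegral W a b c h) := hW.measurable_stepIntegral ha hab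
  have hiso : ∀ m, ∫⁻ ω, ‖stepIntegral W a b c h ω - J m ω‖ₑ ^ 2 ∂P
      = ∫⁻ s in Ioc 0 t, ‖stepFun a b c h s - gridExp lam t m s • e‖ₑ ^ 2 := fun m => by
    rw [hJ, hW.lintegral_stepIntegral_sub_sq ha hab hb (fun _ => gridPoint_nonneg ht m _)
      (fun _ => gridPoint_mono ht m (Nat.le_succ _)) (fun j => gridPoint_le ht (by omega))]
    simp_rw [stepFun_grid]
  have hR : Tendsto (fun m => ∫⁻ s in Ioc 0 t, ‖stepFun a b c h s - gridExp lam t m s • e‖ₑ ^ 2)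
      atTop (𝓝 (∫⁻ s in Ioc 0 t, ‖stepFun a b c h s - Real.exp (-lam * (t - s)) • e‖ₑ ^ 2)) := by
    refine tendsto_lintegral_of_dominated_convergence
      (fun _ => ENNReal.ofReal (((∑ i, ‖c i • h i‖) + Real.exp (|lam| * t) * ‖e‖) ^ 2))
      (fun m => ?_) (fun m => ?_) ?_ ?_
    · exact ((stronglyMeasurable_stepFun a b c h).sub
        ((measurable_gridExp lam t m).stronglyMeasurable.smul_const e)).enorm.pow_const 2
    · refine (ae_restrict_iff' measurableSet_Ioc).2 (ae_of_all _ fun s hs => ?_)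
      beta_reduce
      rw [← ofReal_norm_sq]
      refine ENNReal.ofReal_le_ofReal (pow_le_pow_left₀ (norm_nonneg _) ?_ 2)
      refine (norm_sub_le _ _).trans (add_le_add (norm_stepFun_le _ _ _ _ _) ?_)
      rw [norm_smul, Real.norm_eq_abs]
      gcongr
      exact abs_gridExp_le m hs
    · simp [ENNReal.mul_eq_top]
    · refine (ae_restrict_iff' measurableSet_Ioc).2 (ae_of_all _ fun s hs => ?_)
      have h1 := tendsto_const_nhds (x := stepFun a b c h s).sub
        ((tendsto_gridExp (lam := lam) hs).smul_const e)
      exact ((ENNReal.continuous_pow 2).tendsto _).comp h1.enorm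
  calc ∫⁻ ω, ‖stepIntegral W a b c h ω - ouPath lam (fun s => W s e ω) t‖ₑ ^ 2 ∂P
      = ∫⁻ ω, liminf (fun m => ‖stepIntegral W a b c h ω - J m ω‖ₑ ^ 2) atTop ∂P := by
        refine lintegral_congr_ae ?_
        filter_upwards [hlim] with ω hω
        refine (Tendsto.liminf_eq ?_).symm
        exact ((ENNReal.continuous_pow 2).tendsto _).comp (tendsto_const_nhds.sub hω).enorm
    _ ≤ liminf (fun m => ∫⁻ ω, ‖stepIntegral W a b c h ω - J m ω‖ₑ ^ 2 ∂P) atTop :=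
        lintegral_liminf_le fun m => ((hIm.sub (hJm m)).enorm.pow_const 2)
    _ = _ := by
        simp_rw [hiso]
        exact hR.liminf_eq

end MeanSquare

/-! ### The stochastic convolution in the eigenbasis -/

section Convolution

variable {H : Type*} [NormedAddCommGroup H] [InnerProductSpace ℝ H]
variable {Ω : Type*} {mΩ : MeasurableSpace Ω} {P : Measure Ω} {𝓕 : Filtration ℝ≥0 mΩ}
  {W : ℝ → H → Ω → ℝ}

theorem tendstoInMeasure_of_tendsto_lintegral_sq {E : Type*} [NormedAddCommGroup E]
    {f : ℕ → Ω → E} {g : Ω → E} (hf : ∀ n, AEStronglyMeasurable (f n) P)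
    (hg : AEStronglyMeasurable g P)
    (h : Tendsto (fun n => ∫⁻ ω, ‖f n ω - g ω‖ₑ ^ 2 ∂P) atTop (𝓝 0)) :
    TendstoInMeasure P f atTop g := by
  refine tendstoInMeasure_of_tendsto_eLpNorm_of_ne_top (p := 2) (by simp) (by simp) hf hg ?_
  have h1 : ∀ n, eLpNorm (f n - g) 2 P = (∫⁻ ω, ‖f n ω - g ω‖ₑ ^ 2 ∂P) ^ (1 / 2 : ℝ) := fun n => by
    rw [eLpNorm_eq_lintegral_rpow_enorm_toReal (by simp) (by simp)]
    simp
  simp_rw [h1]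
  have h2 := ((ENNReal.continuous_rpow_const (y := (1 / 2 : ℝ))).tendsto 0).comp h
  simpa [Function.comp_def] using h2

theorem enorm_sq_eq_ofReal (r : ℝ) : ‖r‖ₑ ^ 2 = ENNReal.ofReal (r ^ 2) := by
  rw [← ofReal_norm_sq, Real.norm_eq_abs, sq_abs]

theorem ElementaryIntegrand.inner_integral {t : ℝ} (φ : ElementaryIntegrand H t) (f : H) (ω : Ω) :
    inner ℝ f (φ.integral W ω)
      = stepIntegral W φ.a φ.b (fun i => inner ℝ f (φ.u i)) φ.h ω := by
  simp [ElementaryIntegrand.integral, stepIntegral, inner_sum, inner_smul_right, mul_comm]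

/-- The step function `∑ᵢ 1_{(aᵢ, bᵢ]} ⟨f, uᵢ⟩ hᵢ` is the adjoint of an elementary integrand,
applied to `f`. -/
theorem ElementaryIntegrand.inner_toFun {t : ℝ} (φ : ElementaryIntegrand H t) (f v : H) (s : ℝ) :
    inner ℝ f (φ.toFun s v)
      = inner ℝ (stepFun φ.a φ.b (fun i => inner ℝ f (φ.u i)) φ.h s) v := by
  rw [ElementaryIntegrand.toFun, stepFun, sum_inner, sum_apply, inner_sum]
  refine Finset.sum_congr rfl fun i _ => ?_
  by_cases hi : s ∈ Ioc (φ.a i) (φ.b i)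
  · simp [hi, inner_smul_left, inner_smul_right, mul_comm]
  · simp [hi]

theorem IsCylindricalWiener.stronglyMeasurable_integral (hW : IsCylindricalWiener P 𝓕 W) {t : ℝ}
    (φ : ElementaryIntegrand H t) : StronglyMeasurable (φ.integral W) :=
  Finset.stronglyMeasurable_fun_sum _ fun i _ =>
    (((hW.measurable ((φ.nonneg i).trans (φ.le i)) _).sub
      (hW.measurable (φ.nonneg i) _)).stronglyMeasurable).smul_const _

/-- An elementary integrand whose steps are indexed by a finite type. -/
noncomputable def ElementaryIntegrand.ofFintype {κ : Type*} [Fintype κ] {t : ℝ} (a b : κ → ℝ)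
    (h u : κ → H) (h0 : ∀ i, 0 ≤ a i) (hab : ∀ i, a i ≤ b i) (hb : ∀ i, b i ≤ t) :
    ElementaryIntegrand H t where
  n := Fintype.card κ
  a i := a ((Fintype.equivFin κ).symm i)
  b i := b ((Fintype.equivFin κ).symm i)
  h i := h ((Fintype.equivFin κ).symm i)
  u i := u ((Fintype.equivFin κ).symm i)
  nonneg _ := h0 _
  le _ := hab _
  le_right _ := hb _

variable {ι : Type*} {A : H →ₗ.[ℝ] H} {e : HilbertBasis ι ℝ H} {lam : ι → ℝ} {S : ℝ → H →L[ℝ] H}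

/-- The elementary integrand `∑_{k ∈ F} g_k(s) ⟨e_k, ·⟩ e_k` approximating `S(t - s)`, where `g_k`
is the grid approximation `gridExp` of `exp (-lam_k (t - s))`. -/
noncomputable def semigroupStep (e : HilbertBasis ι ℝ H) (lam : ι → ℝ) {t : ℝ} (ht : 0 ≤ t)
    (F : Finset ι) (m : ℕ) : ElementaryIntegrand H t :=
  ElementaryIntegrand.ofFintype (κ := F × Fin (m + 1))
    (fun i => gridPoint t m i.2) (fun i => gridPoint t m (i.2 + 1)) (fun i => e i.1)
    (fun i => gridWeight (lam i.1) t m i.2 • e i.1)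
    (fun _ => gridPoint_nonneg ht m _) (fun _ => gridPoint_mono ht m (Nat.le_succ _))
    (fun _ => gridPoint_le ht (by omega))

open Classical in
theorem inner_integral_semigroupStep (e : HilbertBasis ι ℝ H) (lam : ι → ℝ) {t : ℝ} (ht : 0 ≤ t)
    (F : Finset ι) (m : ℕ) (k : ι) (ω : Ω) :
    inner ℝ (e k) ((semigroupStep e lam ht F m).integral W ω)
      = if k ∈ F then stepIntegral W (fun j : Fin (m + 1) => gridPoint t m j)
          (fun j => gridPoint t m (j + 1)) (fun j => gridWeight (lam k) t m j) (fun _ => e k) ω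
        else 0 := by
  have h1 : (semigroupStep e lam ht F m).integral W ω
      = ∑ i : F, ∑ j : Fin (m + 1), (W (gridPoint t m (j + 1)) (e i) ω
        - W (gridPoint t m j) (e i) ω) • gridWeight (lam i) t m j • e i := by
    rw [← Fintype.sum_prod_type', ← (Fintype.equivFin (F × Fin (m + 1))).symm.sum_comp]
    rfl
  have h2 := orthonormal_iff_ite.1 e.orthonormal k
  rw [h1, inner_sum]
  simp_rw [inner_sum, inner_smul_right, h2]
  rw [Finset.sum_coe_sort F (fun i => ∑ j : Fin (m + 1), (W (gridPoint t m (j + 1)) (e i) ω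
        - W (gridPoint t m j) (e i) ω) * (gridWeight (lam i) t m j * if k = i then 1 else 0))]
  split_ifs with hk
  · rw [Finset.sum_eq_single_of_mem k hk (fun i _ hi => by simp [Ne.symm hi])]
    simp [stepIntegral, mul_comm]
  · refine Finset.sum_eq_zero fun i hi => ?_
    have : k ≠ i := fun h => hk (h ▸ hi)
    simp [this]

open Classical in
theorem inner_toFun_semigroupStep (e : HilbertBasis ι ℝ H) (lam : ι → ℝ) {t : ℝ} (ht : 0 ≤ t)
    (F : Finset ι) (m : ℕ) (k : ι) (s : ℝ) (v : H) :
    inner ℝ (e k) ((semigroupStep e lam ht F m).toFun s v)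
      = (if k ∈ F then gridExp (lam k) t m s else 0) * inner ℝ (e k) v := by
  have h1 : (semigroupStep e lam ht F m).toFun s v
      = ∑ i : F, ∑ j : Fin (m + 1), (Ioc (gridPoint t m j) (gridPoint t m (j + 1))).indicator
        (fun _ => inner ℝ (e i) v • gridWeight (lam i) t m j • e (i : ι)) s := by
    rw [← Fintype.sum_prod_type', ← (Fintype.equivFin (F × Fin (m + 1))).symm.sum_comp,
      ElementaryIntegrand.toFun, sum_apply]
    refine Finset.sum_congr rfl fun i _ => ?_
    generalize hq : (Fintype.equivFin (F × Fin (m + 1))).symm i = q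
    have h0 : (Ioc ((semigroupStep e lam ht F m).a i) ((semigroupStep e lam ht F m).b i)).indicator
        (fun _ => InnerProductSpace.rankOne ℝ ((semigroupStep e lam ht F m).u i)
          ((semigroupStep e lam ht F m).h i)) s
        = (Ioc (gridPoint t m q.2) (gridPoint t m (q.2 + 1))).indicator
          (fun _ => InnerProductSpace.rankOne ℝ (gridWeight (lam q.1) t m q.2 • e (q.1 : ι))
            (e (q.1 : ι))) s := by rw [← hq]; rfl
    rw [h0]
    by_cases hi : s ∈ Ioc (gridPoint t m q.2) (gridPoint t m (q.2 + 1))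
    · simp [hi, smul_comm (inner ℝ (e (q.1 : ι)) v)]
    · simp [hi]
  have h2 := orthonormal_iff_ite.1 e.orthonormal k
  have h3 : ∀ (i : ι) (j : Fin (m + 1)), inner ℝ (e k)
      ((Ioc (gridPoint t m j) (gridPoint t m (j + 1))).indicator
        (fun _ => inner ℝ (e i) v • gridWeight (lam i) t m j • e i) s)
      = (Ioc (gridPoint t m j) (gridPoint t m (j + 1))).indicator
        (fun _ => gridWeight (lam i) t m j) s * inner ℝ (e i) v * if k = i then 1 else 0 :=
    fun i j => by
      by_cases hj : s ∈ Ioc (gridPoint t m j) (gridPoint t m (j + 1))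
      · simp only [indicator_of_mem hj, inner_smul_right, h2]; ring
      · simp [indicator_of_notMem hj]
  rw [h1, inner_sum]
  simp_rw [inner_sum, h3]
  rw [Finset.sum_coe_sort F (fun i => ∑ j : Fin (m + 1),
    (Ioc (gridPoint t m j) (gridPoint t m (j + 1))).indicator
        (fun _ => gridWeight (lam i) t m j) s * inner ℝ (e i) v * if k = i then 1 else 0)]
  split_ifs with hk
  · rw [Finset.sum_eq_single_of_mem k hk (fun i _ hi => by simp [Ne.symm hi]), gridExp,
      Finset.sum_mul]
    simp
  · rw [zero_mul]
    refine Finset.sum_eq_zero fun i hi => ?_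
    have : k ≠ i := fun h => hk (h ▸ hi)
    simp [this]

open Classical in
/-- The error in the `k`-th coordinate of the approximation of `S(t - s)` by `semigroupStep`. -/
noncomputable def stepError (lam : ι → ℝ) (t : ℝ) (F : Finset ι) (m : ℕ) (k : ι) (s : ℝ) : ℝ :=
  (if k ∈ F then gridExp (lam k) t m s else 0) - Real.exp (-(lam k) * (t - s))

theorem measurable_stepError (lam : ι → ℝ) (t : ℝ) (F : Finset ι) (m : ℕ) (k : ι) :
    Measurable (stepError lam t F m k) := by
  classical
  unfold stepError
  by_cases hk : k ∈ F
  · simp only [hk, if_true]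
    exact (measurable_gridExp _ _ _).sub (by fun_prop)
  · simp only [hk, if_false]
    fun_prop

theorem abs_stepError_le {lam : ι → ℝ} {t : ℝ} {F : Finset ι} {m : ℕ} {k : ι} (hk : 0 ≤ lam k)
    {s : ℝ} (hs : s ∈ Ioc 0 t) : |stepError lam t F m k s| ≤ Real.exp (-(lam k) * (t - s)) := by
  classical
  unfold stepError
  split_ifs
  · obtain ⟨h1, h2⟩ := gridExp_mem_Icc hk m hs
    rw [abs_sub_comm, abs_of_nonneg (by linarith)]
    linarith
  · simp [abs_of_nonneg (Real.exp_nonneg _)]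

/-- Left end point approximation keeps the error below the exponential itself, so that the squared
errors stay below a summable sequence. -/
theorem lintegral_stepError_le {lam : ι → ℝ} {t : ℝ} (ht : 0 ≤ t) (F : Finset ι) (m : ℕ) {k : ι}
    (hk : 0 < lam k) :
    ∫⁻ s in Ioc 0 t, ‖stepError lam t F m k s‖ₑ ^ 2 ≤ ENNReal.ofReal (lam k)⁻¹ := by
  have hd : ∀ s ∈ uIcc 0 t, HasDerivAt (fun s => (lam k)⁻¹ * Real.exp (-(lam k) * (t - s)))
      (Real.exp (-(lam k) * (t - s))) s := fun s _ => by
    have h1 : HasDerivAt (fun s => -(lam k) * (t - s)) (lam k) s := by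
      simpa using ((hasDerivAt_id s).const_sub t).const_mul (-(lam k))
    convert! (h1.exp).const_mul (lam k)⁻¹ using 1
    field_simp
  have hc : Continuous (fun s => Real.exp (-(lam k) * (t - s))) := by fun_prop
  have hint : ∫ s in (0 : ℝ)..t, Real.exp (-(lam k) * (t - s))
      = (lam k)⁻¹ * (1 - Real.exp (-(lam k) * t)) := by
    rw [intervalIntegral.integral_eq_sub_of_hasDerivAt hd (hc.intervalIntegrable _ _)]
    simp [mul_sub]
  calc ∫⁻ s in Ioc 0 t, ‖stepError lam t F m k s‖ₑ ^ 2
      ≤ ∫⁻ s in Ioc 0 t, ENNReal.ofReal (Real.exp (-(lam k) * (t - s))) := by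
        refine setLIntegral_mono' measurableSet_Ioc fun s hs => ?_
        rw [enorm_sq_eq_ofReal, ← sq_abs]
        refine ENNReal.ofReal_le_ofReal ?_
        have h1 := abs_stepError_le (F := F) (m := m) hk.le hs
        have h2 : Real.exp (-(lam k) * (t - s)) ≤ 1 :=
          Real.exp_le_one_iff.2 (by nlinarith [hs.2])
        nlinarith [abs_nonneg (stepError lam t F m k s)]
    _ = ENNReal.ofReal (∫ s in Ioc 0 t, Real.exp (-(lam k) * (t - s))) := by
        rw [ofReal_integral_eq_lintegral_ofReal
          ((hc.integrableOn_Icc).mono_set Ioc_subset_Icc_self)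
          (ae_of_all _ fun _ => Real.exp_nonneg _)]
    _ ≤ ENNReal.ofReal (lam k)⁻¹ := by
        rw [← intervalIntegral.integral_of_le ht, hint]
        refine ENNReal.ofReal_le_ofReal ?_
        refine mul_le_of_le_one_right (inv_nonneg.2 hk.le) ?_
        linarith [Real.exp_nonneg (-(lam k) * t)]

theorem tendsto_lintegral_stepError {lam : ι → ℝ} {t : ℝ} {F : ℕ → Finset ι} {k : ι}
    (hk : 0 ≤ lam k) (hF : ∀ᶠ n in atTop, k ∈ F n) :
    Tendsto (fun n => ∫⁻ s in Ioc 0 t, ‖stepError lam t (F n) n k s‖ₑ ^ 2) atTop (𝓝 0) := by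
  classical
  have h := tendsto_lintegral_of_dominated_convergence (μ := volume.restrict (Ioc 0 t))
    (F := fun n s => ‖stepError lam t (F n) n k s‖ₑ ^ 2) (f := fun _ => 0) (fun _ => 1)
    (fun n => (measurable_stepError _ _ _ _ _).enorm.pow_const 2) (fun n => ?_) (by simp) ?_
  · simpa using h
  · refine (ae_restrict_iff' measurableSet_Ioc).2 (ae_of_all _ fun s hs => ?_)
    beta_reduce
    rw [enorm_sq_eq_ofReal, ← ENNReal.ofReal_one]
    refine ENNReal.ofReal_le_ofReal ?_
    rw [sq_le_one_iff_abs_le_one]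
    exact (abs_stepError_le hk hs).trans (Real.exp_le_one_iff.2 (by nlinarith [hs.2]))
  · refine (ae_restrict_iff' measurableSet_Ioc).2 (ae_of_all _ fun s hs => ?_)
    have h1 : Tendsto (fun n => stepError lam t (F n) n k s) atTop (𝓝 0) := by
      have h2 := (tendsto_gridExp (lam := lam k) hs).sub_const (Real.exp (-(lam k) * (t - s)))
      rw [sub_self] at h2
      refine h2.congr' ?_
      filter_upwards [hF] with n hn
      simp [stepError, hn]
    have h3 := ((ENNReal.continuous_pow 2).tendsto _).comp h1.enorm
    simpa [Function.comp_def] using h3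

theorem tendsto_tsum_lintegral_stepError [Countable ι] {lam : ι → ℝ} (hpos : ∀ k, 0 < lam k)
    (hsum : Summable fun k => (lam k)⁻¹) {t : ℝ} (ht : 0 ≤ t) {F : ℕ → Finset ι}
    (hF : ∀ k, ∀ᶠ n in atTop, k ∈ F n) :
    Tendsto (fun n => ∑' k, ∫⁻ s in Ioc 0 t, ‖stepError lam t (F n) n k s‖ₑ ^ 2) atTop (𝓝 0) := by
  let _ : MeasurableSpace ι := ⊤
  have h := tendsto_lintegral_of_dominated_convergence (μ := Measure.count)
    (F := fun n k => ∫⁻ s in Ioc 0 t, ‖stepError lam t (F n) n k s‖ₑ ^ 2)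
    (f := fun _ => 0) (fun k => ENNReal.ofReal (lam k)⁻¹)
    (fun n => measurable_from_top) (fun n => ae_of_all _ fun k =>
      lintegral_stepError_le ht _ _ (hpos k)) ?_
    (ae_of_all _ fun k => tendsto_lintegral_stepError (hpos k).le (hF k))
  · simpa [lintegral_count] using h
  · rw [lintegral_count]
    exact hsum.tsum_ofReal_ne_top

theorem IsEigenbasis.countable (he : IsEigenbasis A e lam) : Countable ι := by
  have h := he.summable_inv.countable_support
  have h2 : Function.support (fun k => (lam k)⁻¹) = univ :=
    eq_univ_of_forall fun k => inv_ne_zero (he.pos k).ne'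
  rw [h2] at h
  exact countable_univ_iff.1 h

theorem aestronglyMeasurable_of_inner (e : HilbertBasis ι ℝ H) [Countable ι] {Z : Ω → H}
    (hZ : ∀ k, AEMeasurable (fun ω => inner ℝ (e k) (Z ω)) P) : AEStronglyMeasurable Z P := by
  refine aestronglyMeasurable_of_tendsto_ae atTop
    (f := fun (F : Finset ι) ω => ∑ k ∈ F, inner ℝ (e k) (Z ω) • e k) (fun F => ?_)
    (ae_of_all _ fun ω => HilbertBasis.hasSum_inner_smul e (Z ω))
  exact Finset.aestronglyMeasurable_fun_sum _ fun k _ => (hZ k).aestronglyMeasurable.smul_const _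

/-- The coordinates of a stochastic convolution in the eigenbasis are the scalar
Ornstein-Uhlenbeck functionals. -/
theorem IsEigenbasis.inner_stochasticIntegral [IsFiniteMeasure P] (he : IsEigenbasis A e lam)
    (hS : IsSemigroupGeneratedBy S (-A)) (hW : IsCylindricalWiener P 𝓕 W) {t : ℝ} (ht : 0 ≤ t)
    {Z : Ω → H} (hZ : IsStochasticIntegral P W t (fun s => S (t - s)) Z) (k : ι) :
    ∀ᵐ ω ∂P, inner ℝ (e k) (Z ω) = ouPath (lam k) (fun s => W s (e k) ω) t := by
  obtain ⟨hZm, φ, hφ, hφZ⟩ := hZ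
  have hm : ∀ n, AEStronglyMeasurable (fun ω => inner ℝ (e k) ((φ n).integral W ω)) P := fun n =>
    (innerSL ℝ (e k)).continuous.comp_aestronglyMeasurable
      (hW.stronglyMeasurable_integral (φ n)).aestronglyMeasurable
  have hm' : AEStronglyMeasurable (fun ω => inner ℝ (e k) (Z ω)) P :=
    (innerSL ℝ (e k)).continuous.comp_aestronglyMeasurable hZm
  refine tendstoInMeasure_ae_unique (tendstoInMeasure_of_tendsto_lintegral_sq hm hm' ?_)
    (tendstoInMeasure_of_tendsto_lintegral_sq hm
      (hW.aemeasurable_ouPath ht (lam k) (e k)).aestronglyMeasurable ?_)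
  · refine tendsto_of_tendsto_of_tendsto_of_le_of_le tendsto_const_nhds hφZ
      (fun _ => zero_le) (fun n => lintegral_mono fun ω => ?_)
    beta_reduce
    rw [← inner_sub_right, ← ofReal_norm_sq, ← ofReal_norm_sq]
    refine ENNReal.ofReal_le_ofReal (pow_le_pow_left₀ (norm_nonneg _) ?_ 2)
    refine (norm_inner_le_norm _ _).trans ?_
    rw [e.orthonormal.1 k, one_mul]
  · refine tendsto_of_tendsto_of_tendsto_of_le_of_le tendsto_const_nhds hφ
      (fun _ => zero_le) (fun n => ?_)
    simp_rw [ElementaryIntegrand.inner_integral]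
    refine (hW.lintegral_stepIntegral_sub_ouPath_le ht (φ n).nonneg (φ n).le
      (φ n).le_right _ _).trans ?_
    refine setLIntegral_mono' measurableSet_Ioc fun s hs => ?_
    refine enorm_sq_adjoint_le_hsNormSq _ (e.orthonormal.1 k) fun v => ?_
    rw [sub_apply, inner_sub_right, inner_sub_left,
      ElementaryIntegrand.inner_toFun, he.inner_semigroup hS (by linarith [hs.2]),
      inner_smul_left]
    rfl

/-- A random variable with the right coordinates in the eigenbasis is a stochastic convolution:
the operators `semigroupStep` converge in Hilbert-Schmidt norm and their integrals in mean square,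
with both errors controlled by `∑ₖ ∫₀ᵗ (stepError)²`, which tends to zero as `A⁻¹` has finite
trace. -/
theorem IsEigenbasis.isStochasticIntegral (he : IsEigenbasis A e lam)
    (hS : IsSemigroupGeneratedBy S (-A)) (hW : IsCylindricalWiener P 𝓕 W) {t : ℝ} (ht : 0 ≤ t)
    {Z : Ω → H}
    (hZ : ∀ k, ∀ᵐ ω ∂P, inner ℝ (e k) (Z ω) = ouPath (lam k) (fun s => W s (e k) ω) t) :
    IsStochasticIntegral P W t (fun s => S (t - s)) Z := by
  classical
  have := he.countable
  have hYm : ∀ k, AEMeasurable (fun ω => ouPath (lam k) (fun s => W s (e k) ω) t) P :=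
    fun k => hW.aemeasurable_ouPath ht (lam k) (e k)
  have hZm : AEStronglyMeasurable Z P :=
    aestronglyMeasurable_of_inner e fun k => (hYm k).congr ((hZ k).mono fun _ h => h.symm)
  obtain ⟨F, hF⟩ := exists_seq_tendsto (atTop : Filter (Finset ι))
  have hF' : ∀ k, ∀ᶠ n in atTop, k ∈ F n := fun k => by
    filter_upwards [hF.eventually (eventually_ge_atTop {k})] with n hn
    exact hn (Finset.mem_singleton_self k)
  have hlim := tendsto_tsum_lintegral_stepError he.pos he.summable_inv ht hF'
  refine ⟨hZm, fun n => semigroupStep e lam ht (F n) n, ?_, ?_⟩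
  · refine tendsto_of_tendsto_of_tendsto_of_le_of_le tendsto_const_nhds hlim
      (fun _ => zero_le) (fun n => ?_)
    beta_reduce
    rw [← lintegral_tsum fun k =>
      ((measurable_stepError lam t (F n) n k).enorm.pow_const 2).aemeasurable]
    refine setLIntegral_mono' measurableSet_Ioc fun s hs => ?_
    simp_rw [enorm_sq_eq_ofReal]
    refine hsNormSq_le_of_diagonal e _ (fun k => stepError lam t (F n) n k s) fun k v => ?_
    rw [sub_apply, inner_sub_right, inner_toFun_semigroupStep,
      he.inner_semigroup hS (by linarith [hs.2]), stepError, sub_mul]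
  · refine tendsto_of_tendsto_of_tendsto_of_le_of_le tendsto_const_nhds hlim
      (fun _ => zero_le) (fun n => ?_)
    beta_reduce
    simp_rw [← HilbertBasis.tsum_enorm_sq_inner e]
    rw [lintegral_tsum fun k => ?_]
    · refine ENNReal.tsum_le_tsum fun k => ?_
      simp_rw [inner_sub_right, inner_integral_semigroupStep]
      have h1 : ∀ x : ℝ, ‖x • e k‖ₑ ^ 2 = ‖x‖ₑ ^ 2 := fun x => by
        rw [enorm_smul, ← ofReal_norm (e k), e.orthonormal.1 k]; simp
      by_cases hk : k ∈ F n
      · have h2 := hW.lintegral_stepIntegral_sub_ouPath_le ht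
          (κ := Fin (n + 1)) (a := fun j => gridPoint t n j) (b := fun j => gridPoint t n (j + 1))
          (c := fun j => gridWeight (lam k) t n j) (h := fun _ => e k)
          (fun _ => gridPoint_nonneg ht n _) (fun _ => gridPoint_mono ht n (Nat.le_succ _))
          (fun _ => gridPoint_le ht (by omega)) (lam k) (e k)
        simp_rw [stepFun_grid, ← sub_smul, h1] at h2
        simp only [hk, if_true, stepError]
        refine le_trans (le_of_eq (lintegral_congr_ae ?_)) h2
        filter_upwards [hZ k] with ω hω
        rw [hω]
      -- Off `F n` the approximation vanishes, so the estimate is used for the empty step function.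
      · have h2 := hW.lintegral_stepIntegral_sub_ouPath_le ht
          (κ := Fin 0) (a := fun _ => 0) (b := fun _ => 0)
          (c := fun j => 0) (h := fun _ => 0)
          (fun _ => le_rfl) (fun _ => le_rfl) (fun _ => ht) (lam k) (e k)
        simp only [stepIntegral, stepFun, Finset.univ_eq_empty, Finset.sum_empty, zero_sub,
          ← neg_smul, h1] at h2
        simp only [hk, if_false, stepError, zero_sub]
        refine le_trans (le_of_eq (lintegral_congr_ae ?_)) h2
        filter_upwards [hZ k] with ω hω
        rw [hω]
    · refine AEMeasurable.pow_const (AEMeasurable.enorm ?_) 2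
      exact ((innerSL ℝ (e k)).continuous.comp_aestronglyMeasurable
        ((hW.stronglyMeasurable_integral _).aestronglyMeasurable.sub hZm)).aemeasurable

end Convolution

/-! ### The scalar integral equation -/

section ScalarEquation

theorem integral_exp_mul (lam : ℝ) (F : ℝ → ℝ) (t : ℝ) :
    ∫ s in (0 : ℝ)..t, Real.exp (-lam * (t - s)) * F s
      = Real.exp (-lam * t) * ∫ s in (0 : ℝ)..t, Real.exp (lam * s) * F s := by
  rw [← intervalIntegral.integral_const_mul]
  congr 1; funext s
  rw [← mul_assoc, ← Real.exp_add]
  congr 2; ring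

theorem hasDerivAt_exp_const_mul (c s : ℝ) :
    HasDerivAt (fun r => Real.exp (c * r)) (c * Real.exp (c * s)) s := by
  have := ((hasDerivAt_id s).const_mul c).exp
  simpa [mul_comm] using this

theorem eq_ouPath_iff_of_continuous {lam T : ℝ} {y F : ℝ → ℝ} (hy : Continuous y)
    (hF : Continuous F) :
    (∀ t ∈ Icc 0 T, y t = F t - lam * ∫ s in (0 : ℝ)..t, y s) ↔
      ∀ t ∈ Icc 0 T, y t = ouPath lam F t := by
  have hEF : Continuous (fun s => Real.exp (lam * s) * F s) := by fun_prop
  have hu : ∀ t, HasDerivAt (fun t => ∫ s in (0 : ℝ)..t, y s) (y t) t := fun t =>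
    intervalIntegral.integral_hasDerivAt_right (hy.intervalIntegrable _ _)
      hy.stronglyMeasurable.stronglyMeasurableAtFilter hy.continuousAt
  have hv : ∀ t, HasDerivAt (fun t => ∫ s in (0 : ℝ)..t, Real.exp (lam * s) * F s)
      (Real.exp (lam * t) * F t) t := fun t =>
    intervalIntegral.integral_hasDerivAt_right (hEF.intervalIntegrable _ _)
      hEF.stronglyMeasurable.stronglyMeasurableAtFilter hEF.continuousAt
  have hzero : ∀ (D D' : ℝ → ℝ), (∀ t, HasDerivAt D (D' t) t) → D 0 = 0 →
      (∀ t ∈ Icc 0 T, D' t = 0) → ∀ t ∈ Icc 0 T, D t = 0 := by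
    intro D D' hD h0 hD' t ht
    have := constant_of_has_deriv_right_zero (a := 0) (b := T) (f := D)
      (fun s _ => (hD s).continuousAt.continuousWithinAt)
      (fun s hs => by
        have := (hD s).hasDerivWithinAt (s := Ici s)
        rwa [hD' s ⟨hs.1, hs.2.le⟩] at this) t ht
    rw [this, h0]
  have hee : ∀ t, Real.exp (-lam * t) * Real.exp (lam * t) = 1 := fun t => by
    rw [← Real.exp_add]; simp
  unfold ouPath
  simp_rw [integral_exp_mul]
  constructor
  · intro h t ht
    -- `exp (lam t) ∫₀ᵗ y` and `∫₀ᵗ exp (lam s) F(s) ds` have the same derivative.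
    have := hzero (fun t => Real.exp (lam * t) * (∫ s in (0 : ℝ)..t, y s)
        - ∫ s in (0 : ℝ)..t, Real.exp (lam * s) * F s) _
      (fun t => ((hasDerivAt_exp_const_mul lam t).mul (hu t)).sub (hv t)) (by simp)
      (fun t ht => by
        rw [h t ht]; ring) t ht
    rw [h t ht, ← sub_eq_zero.1 this, ← mul_assoc (Real.exp _), hee, one_mul]
  · intro h t ht
    -- `∫₀ᵗ exp (-lam (t - s)) F(s) ds` and `∫₀ᵗ y` have the same derivative.
    have := hzero (fun t => Real.exp (-lam * t) * (∫ s in (0 : ℝ)..t, Real.exp (lam * s) * F s)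
        - ∫ s in (0 : ℝ)..t, y s) _
      (fun t => ((hasDerivAt_exp_const_mul (-lam) t).mul (hv t)).sub (hu t)) (by simp)
      (fun t ht => by
        rw [h t ht, ← mul_assoc, hee]; ring) t ht
    rw [h t ht, sub_eq_zero.1 this]

/-- `ouPath lam F` is the unique continuous solution of `y(t) = F(t) - lam ∫₀ᵗ y(s) ds`. -/
theorem eq_ouPath_iff {lam T : ℝ} (hT : 0 ≤ T) {y F : ℝ → ℝ} (hy : ContinuousOn y (Icc 0 T))
    (hF : ContinuousOn F (Icc 0 T)) :
    (∀ t ∈ Icc 0 T, y t = F t - lam * ∫ s in (0 : ℝ)..t, y s) ↔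
      ∀ t ∈ Icc 0 T, y t = ouPath lam F t := by
  have hmem : ∀ s, max 0 (min T s) ∈ Icc 0 T := fun s =>
    ⟨le_max_left _ _, max_le hT (min_le_left _ _)⟩
  have hclamp : ∀ s ∈ Icc 0 T, max 0 (min T s) = s := fun s hs => by
    rw [min_eq_right hs.2, max_eq_right hs.1]
  have hcont : ∀ {f : ℝ → ℝ}, ContinuousOn f (Icc 0 T) →
      Continuous (fun s => f (max 0 (min T s))) := fun hf =>
    hf.comp_continuous (by fun_prop) hmem
  have key := eq_ouPath_iff_of_continuous (lam := lam) (T := T) (hcont hy) (hcont hF)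
  refine (forall₂_congr fun t ht => ?_).trans (key.trans (forall₂_congr fun t ht => ?_))
  · rw [hclamp t ht, intervalIntegral.integral_congr (g := fun s => y (max 0 (min T s)))]
    intro s hs
    rw [uIcc_of_le ht.1] at hs
    simp only [hclamp s ⟨hs.1, hs.2.trans ht.2⟩]
  · simp only [ouPath, hclamp t ht]
    rw [intervalIntegral.integral_congr (g := fun s => Real.exp (-lam * (t - s)) * F s)]
    intro s hs
    rw [uIcc_of_le ht.1] at hs
    simp only [hclamp s ⟨hs.1, hs.2.trans ht.2⟩]

theorem continuousOn_ouPath {lam T : ℝ} (hT : 0 ≤ T) {w : ℝ → ℝ} (hw : ContinuousOn w (Icc 0 T)) :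
    ContinuousOn (ouPath lam w) (Icc 0 T) := by
  have hi : IntegrableOn (fun s => Real.exp (lam * s) * w s) (uIcc 0 T) := by
    rw [uIcc_of_le hT]
    have hc : Continuous fun s => Real.exp (lam * s) := by fun_prop
    exact (hc.continuousOn.mul hw).integrableOn_Icc
  have hp := intervalIntegral.continuousOn_primitive_interval hi
  rw [uIcc_of_le hT] at hp
  have hE : ContinuousOn (fun t => Real.exp (-lam * t)) (Icc 0 T) := by fun_prop
  refine (hw.sub ((continuousOn_const (c := lam)).mul (hE.mul hp))).congr fun t _ => ?_
  rw [ouPath, integral_exp_mul]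
  rfl

theorem ouPath_const (lam c t : ℝ) : ouPath lam (fun _ => c) t = Real.exp (-lam * t) * c := by
  have h1 : ∫ s in (0 : ℝ)..t, lam * Real.exp (lam * s) = Real.exp (lam * t) - 1 := by
    rw [intervalIntegral.integral_eq_sub_of_hasDerivAt
      (fun s _ => hasDerivAt_exp_const_mul lam s)
      ((by fun_prop : Continuous fun s => lam * Real.exp (lam * s)).intervalIntegrable _ _)]
    simp
  rw [intervalIntegral.integral_const_mul] at h1
  have hee : Real.exp (-lam * t) * Real.exp (lam * t) = 1 := by
    rw [← Real.exp_add]; simp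
  rw [ouPath, integral_exp_mul, intervalIntegral.integral_mul_const]
  linear_combination (-Real.exp (-lam * t) * c) * h1 - c * hee

theorem ouPath_add {lam t : ℝ} (ht : 0 ≤ t) {v w : ℝ → ℝ} (hv : ContinuousOn v (Icc 0 t))
    (hw : ContinuousOn w (Icc 0 t)) :
    ouPath lam (fun s => v s + w s) t = ouPath lam v t + ouPath lam w t := by
  have hi : ∀ {f : ℝ → ℝ}, ContinuousOn f (Icc 0 t) →
      IntervalIntegrable (fun s => Real.exp (-lam * (t - s)) * f s) volume 0 t := fun hf => by
    refine ContinuousOn.intervalIntegrable ?_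
    rw [uIcc_of_le ht]
    exact (by fun_prop : Continuous fun s => Real.exp (-lam * (t - s))).continuousOn.mul hf
  unfold ouPath
  simp_rw [mul_add]
  rw [intervalIntegral.integral_add (hi hv) (hi hw)]
  ring

theorem ouPath_neg (lam t : ℝ) (w : ℝ → ℝ) :
    ouPath lam (fun s => -w s) t = -ouPath lam w t := by
  unfold ouPath
  simp_rw [mul_neg]
  rw [intervalIntegral.integral_neg]
  ring

/-- Integration by parts against a measure, by Fubini's theorem. -/
theorem ouPath_integral {lam t : ℝ} (ht : 0 ≤ t) (ν : Measure ℝ) [IsFiniteMeasure ν]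
    {f : ℝ → ℝ} (hf : IntegrableOn f (Ioc 0 t) ν) :
    ouPath lam (fun s => ∫ r in Ioc 0 s, f r ∂ν) t
      = ∫ r in Ioc 0 t, Real.exp (-lam * (t - r)) * f r ∂ν := by
  set ρ : ℝ → ℝ := fun s => Real.exp (-lam * (t - s)) with hρ
  have hρc : Continuous ρ := by fun_prop
  have hρd : ∀ s, HasDerivAt ρ (lam * ρ s) s := fun s => by
    have h1 : HasDerivAt (fun s => -lam * (t - s)) lam s := by
      simpa using ((hasDerivAt_id s).const_sub t).const_mul (-lam)
    simpa [hρ, mul_comm] using h1.exp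
  have hρi : IntegrableOn (fun s => lam * ρ s) (Ioc 0 t) volume :=
    (continuous_const.mul hρc).integrableOn_Icc.mono_set Ioc_subset_Icc_self
  let D : Set (ℝ × ℝ) := {p | p.2 ≤ p.1}
  have hD : MeasurableSet D := measurableSet_le measurable_snd measurable_fst
  have hint : Integrable (Function.uncurry fun s r => D.indicator
      (fun p : ℝ × ℝ => lam * ρ p.1 * f p.2) (s, r))
      ((volume.restrict (Ioc 0 t)).prod (ν.restrict (Ioc 0 t))) := by
    have := (Integrable.mul_prod hρi hf).indicator hD
    exact this
  have hswap := integral_integral_swap hint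
  have hleft : ∫ s in Ioc 0 t, ∫ r in Ioc 0 t, D.indicator
        (fun p : ℝ × ℝ => lam * ρ p.1 * f p.2) (s, r) ∂ν
      = lam * ∫ s in (0 : ℝ)..t, ρ s * ∫ r in Ioc 0 s, f r ∂ν := by
    rw [← intervalIntegral.integral_const_mul, intervalIntegral.integral_of_le ht]
    refine setIntegral_congr_fun measurableSet_Ioc fun s hs => ?_
    have h1 : ∀ r, D.indicator (fun p : ℝ × ℝ => lam * ρ p.1 * f p.2) (s, r)
        = (Iic s).indicator (fun r => lam * ρ s * f r) r := fun r => by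
      by_cases hr : r ≤ s
      · rw [indicator_of_mem (show (s, r) ∈ D from hr),
          indicator_of_mem (show r ∈ Iic s from hr)]
      · rw [indicator_of_notMem (show (s, r) ∉ D from hr),
          indicator_of_notMem (show r ∉ Iic s from hr)]
    simp_rw [h1]
    rw [setIntegral_indicator (measurableSet_Iic (a := s)), integral_const_mul, mul_assoc]
    have h2 : Ioc 0 t ∩ Iic s = Ioc 0 s := by
      rw [Ioc_inter_Iic, min_eq_right hs.2]
    rw [h2]
  have hright : ∫ r in Ioc 0 t, (∫ s in Ioc 0 t, D.indicator
        (fun p : ℝ × ℝ => lam * ρ p.1 * f p.2) (s, r)) ∂ν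
      = ∫ r in Ioc 0 t, (f r - ρ r * f r) ∂ν := by
    refine setIntegral_congr_fun measurableSet_Ioc fun r hr => ?_
    have h1 : ∀ s, D.indicator (fun p : ℝ × ℝ => lam * ρ p.1 * f p.2) (s, r)
        = (Ici r).indicator (fun s => lam * ρ s * f r) s := fun s => by
      by_cases hs : r ≤ s
      · rw [indicator_of_mem (show (s, r) ∈ D from hs),
          indicator_of_mem (show s ∈ Ici r from hs)]
      · rw [indicator_of_notMem (show (s, r) ∉ D from hs),
          indicator_of_notMem (show s ∉ Ici r from hs)]
    simp_rw [h1]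
    have h2 : Ioc 0 t ∩ Ici r = Icc r t := by
      ext s
      simp only [mem_inter_iff, mem_Ioc, mem_Ici, mem_Icc]
      exact ⟨fun h => ⟨h.2, h.1.2⟩, fun h => ⟨⟨hr.1.trans_le h.1, h.2⟩, h.1⟩⟩
    rw [setIntegral_indicator (measurableSet_Ici (a := r)), h2, integral_mul_const,
      integral_Icc_eq_integral_Ioc, ← intervalIntegral.integral_of_le hr.2,
      intervalIntegral.integral_eq_sub_of_hasDerivAt (fun s _ => hρd s)
        ((continuous_const.mul hρc).intervalIntegrable _ _)]
    simp [hρ, sub_mul]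
  have hρf : IntegrableOn (fun r => ρ r * f r) (Ioc 0 t) ν := by
    refine Integrable.bdd_mul hf hρc.aestronglyMeasurable
      (c := Real.exp (|lam| * t))
      ((ae_restrict_iff' measurableSet_Ioc).2 (ae_of_all _ fun s hs => ?_))
    rw [Real.norm_of_nonneg (Real.exp_nonneg _), Real.exp_le_exp]
    have h1 : 0 ≤ t - s := by linarith [hs.2]
    calc -lam * (t - s) ≤ |lam| * (t - s) := by gcongr; exact neg_le_abs lam
      _ ≤ |lam| * t := by gcongr; linarith [hs.1]
  rw [integral_sub hf hρf] at hright
  rw [ouPath]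
  change _ - lam * ∫ s in (0 : ℝ)..t, ρ s * _ = _
  rw [← hleft, hswap, hright]
  ring

end ScalarEquation

/-! ### Pathwise convolutions -/

section PathMeasure

theorem monotone_stieltjes_eq_of_continuous {f : ℝ → ℝ} (hf : Monotone f) (hc : Continuous f) :
    (hf.stieltjesFunction : ℝ → ℝ) = f := by
  funext x
  rw [hf.stieltjesFunction_eq]
  exact (hc.continuousAt.continuousWithinAt).rightLim_eq

theorem continuous_clampPath {T : ℝ} (hT : 0 ≤ T) {f : ℝ → ℝ} (hf : ContinuousOn f (Icc 0 T)) :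
    Continuous (clampPath T f) :=
  hf.comp_continuous (by fun_prop) fun _ => ⟨le_max_left _ _, max_le hT (min_le_left _ _)⟩

theorem isFiniteMeasure_pathMeasure {T : ℝ} {f : ℝ → ℝ} (hf : ContinuousOn f (Icc 0 T)) :
    IsFiniteMeasure (pathMeasure T f) := by
  unfold pathMeasure
  split_ifs with h
  · refine StieltjesFunction.isFiniteMeasure_of_forall_abs_le _ (C := |f 0| + |f T|) fun x => ?_
    rw [monotone_stieltjes_eq_of_continuous _ (continuous_clampPath h.1 hf), clampPath]
    have hx : max 0 (min T x) ∈ Icc 0 T := ⟨le_max_left _ _, max_le h.1 (min_le_left _ _)⟩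
    have h1 := h.2 ⟨le_rfl, h.1⟩ hx hx.1
    have h2 := h.2 hx ⟨h.1, le_rfl⟩ hx.2
    rw [abs_le]
    constructor
    · linarith [neg_abs_le (f 0), abs_nonneg (f T)]
    · linarith [le_abs_self (f T), abs_nonneg (f 0)]
  · infer_instance

theorem nullSingletonClass_pathMeasure {T : ℝ} {f : ℝ → ℝ} (hf : ContinuousOn f (Icc 0 T)) :
    NullSingletonClass (pathMeasure T f) := by
  unfold pathMeasure
  split_ifs with h
  · refine ⟨fun x => ?_⟩
    have hc := continuous_clampPath h.1 hf
    rw [StieltjesFunction.measure_singleton, monotone_stieltjes_eq_of_continuous _ hc,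
      (hc.continuousAt.continuousWithinAt).leftLim_eq, sub_self, ENNReal.ofReal_zero]
  · exact ⟨fun x => rfl⟩

variable {H : Type*} [NormedAddCommGroup H]

theorem integrableOn_convolution {T t : ℝ} (ht : t ≤ T) {ν : Measure ℝ} [IsFiniteMeasure ν]
    {G : ℝ × H → H} (hG : Continuous G) (hG1 : ∀ p, ‖G p‖ ≤ ‖p.2‖) {q : ℝ → H}
    (hq : AEStronglyMeasurable q (ν.restrict (Ioc 0 T))) (hq1 : ∀ s, ‖q s‖ ≤ 1) :
    IntegrableOn (fun s => G (t - s, q s)) (Ioc 0 t) ν := by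
  have hm : AEStronglyMeasurable (fun s => G (t - s, q s)) (ν.restrict (Ioc 0 T)) :=
    hG.comp_aestronglyMeasurable
      ((by fun_prop : Continuous fun s => t - s).aestronglyMeasurable.prodMk hq)
  exact Integrable.of_bound (hm.mono_measure (Measure.restrict_mono_set _
    (Ioc_subset_Ioc_right ht))) 1 (ae_of_all _ fun s => (hG1 _).trans (hq1 s))

theorem integrableOn_of_norm_le_one {T t : ℝ} (ht : t ≤ T) {ν : Measure ℝ} [IsFiniteMeasure ν] {q : ℝ → H}
    (hq : AEStronglyMeasurable q (ν.restrict (Ioc 0 T))) (hq1 : ∀ s, ‖q s‖ ≤ 1) :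
    IntegrableOn q (Ioc 0 t) ν :=
  integrableOn_convolution (G := fun p : ℝ × H => p.2) ht continuous_snd (fun _ => le_rfl) hq hq1

/-- The convolution `t ↦ ∫_{(0, t]} G(t - s, q(s)) dν(s)` is continuous: the integrand jumps at
`t = s` only, and `ν` has no atoms. -/
theorem continuousOn_convolution [NormedSpace ℝ H] {T : ℝ} {ν : Measure ℝ} [IsFiniteMeasure ν] [NullSingletonClass ν]
    {G : ℝ × H → H} (hG : Continuous G) (hG1 : ∀ p, ‖G p‖ ≤ ‖p.2‖) {q : ℝ → H}
    (hq : AEStronglyMeasurable q (ν.restrict (Ioc 0 T))) (hq1 : ∀ s, ‖q s‖ ≤ 1) :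
    ContinuousOn (fun t => ∫ s in Ioc 0 t, G (t - s, q s) ∂ν) (Icc 0 T) := by
  have hm : ∀ t, AEStronglyMeasurable (fun s => G (t - s, q s)) (ν.restrict (Ioc 0 T)) := fun t =>
    hG.comp_aestronglyMeasurable
      ((by fun_prop : Continuous fun s => t - s).aestronglyMeasurable.prodMk hq)
  have hc : Continuous (fun t => ∫ s in Ioc 0 T,
      (Iic t).indicator (fun s => G (t - s, q s)) s ∂ν) := by
    rw [continuous_iff_continuousAt]
    intro t
    refine continuousAt_of_dominated (bound := fun _ => 1)
      (Eventually.of_forall fun t => (hm t).indicator measurableSet_Iic)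
      (Eventually.of_forall fun t => ae_of_all _ fun s => ?_) (integrable_const _) ?_
    · exact (norm_indicator_le_norm_self _ _).trans ((hG1 _).trans (hq1 s))
    · have hne : ∀ᵐ s ∂(ν.restrict (Ioc 0 T)), s ≠ t :=
        ae_restrict_of_ae (by simp [ae_iff])
      filter_upwards [hne] with s hs
      rcases lt_or_gt_of_ne hs with h | h
      · refine ContinuousAt.congr (f := fun r => G (r - s, q s)) (by fun_prop) ?_
        filter_upwards [lt_mem_nhds h] with r hr
        rw [indicator_of_mem (show s ∈ Iic r from hr.le)]
      · refine ContinuousAt.congr (f := fun _ => (0 : H)) (by fun_prop) ?_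
        filter_upwards [gt_mem_nhds h] with r hr
        rw [indicator_of_notMem (show s ∉ Iic r from not_le.2 hr)]
  refine hc.continuousOn.congr fun t ht => ?_
  beta_reduce
  rw [setIntegral_indicator measurableSet_Iic, Ioc_inter_Iic, min_eq_right ht.2]

end PathMeasure

/-! ### The two equations along one path -/

section Pathwise

variable {H : Type*} [NormedAddCommGroup H] [InnerProductSpace ℝ H]
variable {ι : Type*} {A : H →ₗ.[ℝ] H} {e : HilbertBasis ι ℝ H} {lam : ι → ℝ} {S : ℝ → H →L[ℝ] H}
  {T : ℝ} {ν : Measure ℝ} [IsFiniteMeasure ν] {q : ℝ → H}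

theorem continuousOn_integral_Ioc [NullSingletonClass ν]
    (hq : AEStronglyMeasurable q (ν.restrict (Ioc 0 T))) (hq1 : ∀ s, ‖q s‖ ≤ 1) :
    ContinuousOn (fun t => ∫ s in Ioc 0 t, q s ∂ν) (Icc 0 T) :=
  continuousOn_convolution (G := fun p : ℝ × H => p.2) continuous_snd (fun _ => le_rfl) hq hq1

theorem IsEigenbasis.integrableOn_semigroup (he : IsEigenbasis A e lam)
    (hS : IsSemigroupGeneratedBy S (-A)) {t : ℝ} (ht : t ≤ T)
    (hq : AEStronglyMeasurable q (ν.restrict (Ioc 0 T))) (hq1 : ∀ s, ‖q s‖ ≤ 1) :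
    IntegrableOn (fun s => S (t - s) (q s)) (Ioc 0 t) ν := by
  refine (integrableOn_convolution ht (he.continuous_semigroup hS)
    (fun p => he.norm_semigroup_le hS (le_max_right _ _) _) hq hq1).congr_fun (fun s hs => ?_)
    measurableSet_Ioc
  simp only [max_eq_left (sub_nonneg.2 hs.2)]

theorem IsEigenbasis.continuousOn_semigroup (he : IsEigenbasis A e lam)
    (hS : IsSemigroupGeneratedBy S (-A)) [NullSingletonClass ν]
    (hq : AEStronglyMeasurable q (ν.restrict (Ioc 0 T))) (hq1 : ∀ s, ‖q s‖ ≤ 1) :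
    ContinuousOn (fun t => ∫ s in Ioc 0 t, S (t - s) (q s) ∂ν) (Icc 0 T) := by
  refine (continuousOn_convolution (he.continuous_semigroup hS)
    (fun p => he.norm_semigroup_le hS (le_max_right _ _) _) hq hq1).congr fun t _ => ?_
  refine setIntegral_congr_fun measurableSet_Ioc fun s hs => ?_
  simp only [max_eq_left (sub_nonneg.2 hs.2)]

theorem IsEigenbasis.inner_integral_semigroup [CompleteSpace H] (he : IsEigenbasis A e lam)
    (hS : IsSemigroupGeneratedBy S (-A)) {t : ℝ} (ht : t ∈ Icc 0 T)
    (hq : AEStronglyMeasurable q (ν.restrict (Ioc 0 T))) (hq1 : ∀ s, ‖q s‖ ≤ 1) (k : ι) :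
    inner ℝ (e k) (∫ s in Ioc 0 t, S (t - s) (q s) ∂ν)
      = ouPath (lam k) (fun r => inner ℝ (e k) (∫ s in Ioc 0 r, q s ∂ν)) t := by
  have hqi : ∀ {r}, r ≤ T → IntegrableOn q (Ioc 0 r) ν := fun hr =>
    integrableOn_of_norm_le_one hr hq hq1
  rw [← integral_inner (he.integrableOn_semigroup hS ht.2 hq hq1)]
  have h1 : ∫ s in Ioc 0 t, inner ℝ (e k) (S (t - s) (q s)) ∂ν
      = ∫ s in Ioc 0 t, Real.exp (-(lam k) * (t - s)) * inner ℝ (e k) (q s) ∂ν :=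
    setIntegral_congr_fun measurableSet_Ioc fun s hs =>
      he.inner_semigroup hS (sub_nonneg.2 hs.2) k (q s)
  have h2 : IntegrableOn (fun s => inner ℝ (e k) (q s)) (Ioc 0 t) ν :=
    Integrable.const_inner (𝕜 := ℝ) (e k) (hqi ht.2)
  rw [h1, ← ouPath_integral ht.1 ν h2, ouPath, ouPath, ← integral_inner (hqi ht.2)]
  rw [intervalIntegral.integral_congr]
  intro s hs
  rw [uIcc_of_le ht.1] at hs
  beta_reduce
  rw [← integral_inner (hqi (hs.2.trans ht.2))]

/-- Tested with an eigenvector, the variational equation along one path is the variation of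
constants formula for the path. -/
theorem IsEigenbasis.variational_iff_mild [CompleteSpace H] (he : IsEigenbasis A e lam)
    (hS : IsSemigroupGeneratedBy S (-A)) [NullSingletonClass ν] (hT : 0 ≤ T) {p : ℝ → H}
    (hp : ContinuousOn p (Icc 0 T)) {w : ℝ → ℝ} (hw : ContinuousOn w (Icc 0 T))
    (hq : AEStronglyMeasurable q (ν.restrict (Ioc 0 T))) (hq1 : ∀ s, ‖q s‖ ≤ 1) (x : H) (k : ι) :
    (∀ t ∈ Icc 0 T, inner ℝ (e k) (p t - x) = w t - inner ℝ (e k) (∫ s in Ioc 0 t, q s ∂ν)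
        - lam k * ∫ s in (0 : ℝ)..t, inner ℝ (e k) (p s)) ↔
      ∀ t ∈ Icc 0 T, inner ℝ (e k) (p t - S t x + ∫ s in Ioc 0 t, S (t - s) (q s) ∂ν)
        = ouPath (lam k) w t := by
  have hM : ContinuousOn (fun t => inner ℝ (e k) (∫ s in Ioc 0 t, q s ∂ν)) (Icc 0 T) :=
    continuousOn_const.inner (𝕜 := ℝ) (continuousOn_integral_Ioc hq hq1)
  have hy : ContinuousOn (fun t => inner ℝ (e k) (p t)) (Icc 0 T) :=
    continuousOn_const.inner (𝕜 := ℝ) hp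
  have hF : ContinuousOn (fun t => inner ℝ (e k) x
      + (w t + -inner ℝ (e k) (∫ s in Ioc 0 t, q s ∂ν))) (Icc 0 T) :=
    continuousOn_const.add (hw.add hM.neg)
  have key := eq_ouPath_iff (lam := lam k) hT hy hF
  rw [forall₂_congr fun t ht => ?_, key, forall₂_congr fun t ht => ?_]
  · have hsub : Icc 0 t ⊆ Icc 0 T := Icc_subset_Icc_right ht.2
    have hwM : ContinuousOn (fun t => w t + -inner ℝ (e k) (∫ s in Ioc 0 t, q s ∂ν)) (Icc 0 t) :=
      (hw.add hM.neg).mono hsub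
    have hMn : ContinuousOn (fun t => -inner ℝ (e k) (∫ s in Ioc 0 t, q s ∂ν)) (Icc 0 t) :=
      hM.neg.mono hsub
    rw [ouPath_add ht.1 continuousOn_const hwM, ouPath_add ht.1 (hw.mono hsub) hMn, ouPath_neg, ouPath_const, inner_add_right,
      inner_sub_right, he.inner_semigroup hS ht.1, he.inner_integral_semigroup hS ht hq hq1]
    constructor <;> intro h <;> linarith
  · rw [inner_sub_right]
    constructor <;> intro h <;> linarith

end Pathwise

/-! ### From eigenvectors to the whole domain -/

section Extension

theorem ae_forall_eq_of_continuousOn {Ω : Type*} {mΩ : MeasurableSpace Ω} {P : Measure Ω}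
    {E : Type*} [TopologicalSpace E] [T2Space E] {T : ℝ} {f g : ℝ → Ω → E}
    (hf : ∀ᵐ ω ∂P, ContinuousOn (fun t => f t ω) (Icc 0 T))
    (hg : ∀ᵐ ω ∂P, ContinuousOn (fun t => g t ω) (Icc 0 T))
    (h : ∀ t ∈ Icc 0 T, ∀ᵐ ω ∂P, f t ω = g t ω) :
    ∀ᵐ ω ∂P, ∀ t ∈ Icc 0 T, f t ω = g t ω := by
  obtain ⟨D, hDc, hD⟩ := TopologicalSpace.exists_countable_dense (Icc (0 : ℝ) T)
  have h1 : ∀ᵐ ω ∂P, ∀ t ∈ D, f t ω = g t ω :=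
    (ae_ball_iff hDc).2 fun t _ => h t t.2
  filter_upwards [hf, hg, h1] with ω hfω hgω hω t ht
  have := Continuous.ext_on hD (continuousOn_iff_continuous_domRestrict.1 hfω)
    (continuousOn_iff_continuous_domRestrict.1 hgω) (fun t ht => hω t ht)
  exact congrFun this ⟨t, ht⟩

variable {H : Type*} [NormedAddCommGroup H] [InnerProductSpace ℝ H]
variable {Ω : Type*} {mΩ : MeasurableSpace Ω} {P : Measure Ω} {𝓕 : Filtration ℝ≥0 mΩ}
  {W : ℝ → H → Ω → ℝ}

/-- `W t l` is the mean square limit of `∑_{k ∈ F} ⟨e_k, l⟩ W t e_k`, so it agrees almost surely with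
any almost sure limit of these sums. -/
theorem IsCylindricalWiener.ae_eq_of_tendsto_sum [IsFiniteMeasure P]
    (hW : IsCylindricalWiener P 𝓕 W) {ι : Type*} (e : HilbertBasis ι ℝ H) (l : H) {t : ℝ}
    (ht : 0 ≤ t) {F : ℕ → Finset ι} (hF : Tendsto F atTop atTop) {Y : Ω → ℝ}
    (hY : ∀ᵐ ω ∂P, Tendsto (fun n => ∑ k ∈ F n, inner ℝ (e k) l * W t (e k) ω) atTop
      (𝓝 (Y ω))) :
    ∀ᵐ ω ∂P, Y ω = W t l ω := by
  have hm : ∀ n, AEStronglyMeasurable (fun ω => ∑ k ∈ F n, inner ℝ (e k) l * W t (e k) ω) P :=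
    fun n => (Finset.measurable_sum _ fun k _ =>
      (hW.measurable ht (e k)).const_mul _).aestronglyMeasurable
  refine tendstoInMeasure_ae_unique (tendstoInMeasure_of_tendsto_ae hm hY)
    (tendstoInMeasure_of_tendsto_lintegral_sq hm (hW.measurable ht l).aestronglyMeasurable ?_)
  have h1 : ∀ n, ∫⁻ ω, ‖∑ k ∈ F n, inner ℝ (e k) l * W t (e k) ω - W t l ω‖ₑ ^ 2 ∂P
      = ‖∑ k ∈ F n, inner ℝ (e k) l • e k - l‖ₑ ^ 2 * ENNReal.ofReal t := fun n => by
    have h2 := hW.lintegral_stepIntegral_sub_sq (t := t)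
      (a := fun _ : F n => 0) (b := fun _ => t) (c := fun k => inner ℝ (e k) l)
      (h := fun k => e k) (a' := fun _ : Unit => 0) (b' := fun _ => t) (c' := fun _ => 1)
      (h' := fun _ => l) (fun _ => le_rfl) (fun _ => ht) (fun _ => le_rfl)
      (fun _ => le_rfl) (fun _ => ht) (fun _ => le_rfl)
    have h3 : ∫⁻ s in Ioc 0 t, ‖stepFun (fun _ : F n => 0) (fun _ => t)
        (fun k => inner ℝ (e k) l) (fun k => e k) s
        - stepFun (fun _ : Unit => 0) (fun _ => t) (fun _ => 1) (fun _ => l) s‖ₑ ^ 2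
        = ∫⁻ _ in Ioc 0 t, ‖∑ k ∈ F n, inner ℝ (e k) l • e k - l‖ₑ ^ 2 :=
      setLIntegral_congr_fun measurableSet_Ioc fun s hs => by
        simp only [stepFun, indicator_of_mem hs, Finset.univ_unique, Finset.sum_singleton,
          one_smul]
        rw [Finset.sum_coe_sort (F n) (fun k => inner ℝ (e k) l • e k)]
    rw [h3, setLIntegral_const, Real.volume_Ioc, sub_zero] at h2
    rw [← h2]
    refine lintegral_congr_ae ?_
    have h0 : ∀ᵐ ω ∂P, ∀ k ∈ F n, W 0 (e k) ω = 0 :=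
      (ae_ball_iff (F n).countable_toSet).2 fun k _ => hW.zero (e k)
    filter_upwards [h0, hW.zero l] with ω hω hl
    simp only [stepIntegral, Finset.univ_unique, Finset.sum_singleton, one_mul, hl, sub_zero]
    rw [Finset.sum_coe_sort (F n) (fun k => inner ℝ (e k) l * (W t (e k) ω - W 0 (e k) ω)),
      Finset.sum_congr rfl fun k hk => by rw [← sub_zero (W t (e k) ω), ← hω k hk]]
  simp_rw [h1]
  have h2 : Tendsto (fun n => ∑ k ∈ F n, inner ℝ (e k) l • e k - l) atTop (𝓝 0) := by
    have := (Tendsto.comp (HilbertBasis.hasSum_inner_smul e l) hF).sub_const l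
    rw [sub_self] at this
    exact this
  have h3 : Tendsto (fun n => ‖∑ k ∈ F n, inner ℝ (e k) l • e k - l‖ₑ ^ 2) atTop (𝓝 0) := by
    have := ((ENNReal.continuous_pow 2).tendsto _).comp h2.enorm
    simpa [Function.comp_def] using this
  have h4 := ENNReal.Tendsto.mul_const (b := ENNReal.ofReal t) h3 (Or.inr ENNReal.ofReal_ne_top)
  rwa [zero_mul] at h4

variable {ι : Type*} {A : H →ₗ.[ℝ] H} {e : HilbertBasis ι ℝ H} {lam : ι → ℝ}

theorem IsEigenbasis.inner_apply_eq [CompleteSpace H] (he : IsEigenbasis A e lam)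
    (hA : IsSelfAdjoint A) (l : A.domain) (k : ι) :
    inner ℝ (e k) (A l) = lam k * inner ℝ (e k) (l : H) := by
  obtain ⟨hm, hAe⟩ := he.apply_eq k
  have := isSymmetric_of_isSelfAdjoint hA ⟨e k, hm⟩ l
  rw [hAe, inner_smul_left] at this
  exact this.symm

/-- A linear identity tested by all eigenvectors holds for every `l` in the domain: `l` and `A l`
are the limits of their partial eigenvector expansions. -/
theorem IsEigenbasis.ae_eq_of_forall_eigenvector [IsFiniteMeasure P] [CompleteSpace H]
    (he : IsEigenbasis A e lam) (hA : IsSelfAdjoint A) (hW : IsCylindricalWiener P 𝓕 W) {t : ℝ}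
    (ht : 0 ≤ t) {R V : Ω → H}
    (h : ∀ k, ∀ᵐ ω ∂P, inner ℝ (e k) (R ω) + lam k * inner ℝ (e k) (V ω) = W t (e k) ω)
    (l : A.domain) :
    ∀ᵐ ω ∂P, inner ℝ (l : H) (R ω) + inner ℝ (A l) (V ω) = W t l ω := by
  have := he.countable
  obtain ⟨F, hF⟩ := exists_seq_tendsto (atTop : Filter (Finset ι))
  refine hW.ae_eq_of_tendsto_sum e l ht hF ?_
  filter_upwards [ae_all_iff.2 h] with ω hω
  have h1 := (e.hasSum_inner_mul_inner (l : H) (R ω)).add (e.hasSum_inner_mul_inner (A l) (V ω))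
  refine (Tendsto.comp h1 hF).congr fun n => ?_
  refine Finset.sum_congr rfl fun k _ => ?_
  beta_reduce
  rw [← hω k, real_inner_comm (e k) (l : H), real_inner_comm (e k) (A l), he.inner_apply_eq hA]
  ring

end Extension

/-! ### The exterior normal -/

section Normal

variable {H : Type*} [NormedAddCommGroup H] [InnerProductSpace ℝ H] [CompleteSpace H]

theorem norm_exteriorNormal_le (g : H → ℝ) (x : H) : ‖exteriorNormal g x‖ ≤ 1 := by
  rw [exteriorNormal, norm_smul, norm_inv, norm_norm]
  exact inv_mul_le_one

theorem measurable_exteriorNormal [MeasurableSpace H] [BorelSpace H] [SecondCountableTopology H]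
    {g : H → ℝ} (hg : ContDiff ℝ 1 g) : Measurable (exteriorNormal g) := by
  have h1 : Continuous (gradient g) := by
    unfold gradient
    exact (InnerProductSpace.toDual ℝ H).symm.continuous.comp (hg.continuous_fderiv (by simp))
  exact h1.measurable.norm.inv.smul h1.measurable

end Normal

/-! ### Variational and mild solutions -/

section RegularPath

variable {H : Type*} [NormedAddCommGroup H]
variable {Ω : Type*} {mΩ : MeasurableSpace Ω} {P : Measure Ω} {𝓕 : Filtration ℝ≥0 mΩ}
  {W : ℝ → H → Ω → ℝ} {Γ : Set H} {T : ℝ} {X : ℝ → Ω → H} {L : ℝ → Ω → ℝ}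

/-- The regularity of a single path used in the pathwise comparison of the two equations: `p` is the
path of `X`, `q` the normal along it, and `ν = dL`. -/
structure IsRegularPath (T : ℝ) (p q : ℝ → H) (ν : Measure ℝ) : Prop where
  continuousOn : ContinuousOn p (Icc 0 T)
  aestronglyMeasurable : AEStronglyMeasurable q (ν.restrict (Ioc 0 T))
  norm_le : ∀ s, ‖q s‖ ≤ 1
  finite : IsFiniteMeasure ν
  nullSingleton : NullSingletonClass ν

theorem IsReflectedPair.isRegularPath [MeasurableSpace H] [BorelSpace H]
    [SecondCountableTopology H] (h : IsReflectedPair P 𝓕 T Γ X L) {n : H → H}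
    (hn : Measurable n) (hn1 : ∀ y, ‖n y‖ ≤ 1) :
    ∀ᵐ ω ∂P, IsRegularPath T (fun s => X s ω) (fun s => n (X s ω))
      (pathMeasure T (fun s => L s ω)) := by
  filter_upwards [h.continuous_X, h.continuous_L] with ω hX hL
  refine ⟨hX, ?_, fun s => hn1 _, isFiniteMeasure_pathMeasure hL, nullSingletonClass_pathMeasure hL⟩
  have h1 : AEMeasurable (fun s => X s ω) ((pathMeasure T fun s => L s ω).restrict (Ioc 0 T)) :=
    (hX.mono Ioc_subset_Icc_self).aemeasurable measurableSet_Ioc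
  exact (hn.comp_aemeasurable h1).aestronglyMeasurable

end RegularPath

section Equivalence

variable {H : Type*} [NormedAddCommGroup H] [InnerProductSpace ℝ H] [CompleteSpace H]
variable {Ω : Type*} {mΩ : MeasurableSpace Ω} {P : Measure Ω} {𝓕 : Filtration ℝ≥0 mΩ}
  {W : ℝ → H → Ω → ℝ} {Γ : Set H} {T : ℝ} {X : ℝ → Ω → H} {L : ℝ → Ω → ℝ}
variable {ι : Type*} {A : H →ₗ.[ℝ] H} {e : HilbertBasis ι ℝ H} {lam : ι → ℝ} {S : ℝ → H →L[ℝ] H}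

theorem IsSolution.isMildSolution [MeasurableSpace H] [BorelSpace H] [SecondCountableTopology H]
    (he : IsEigenbasis A e lam) (hS : IsSemigroupGeneratedBy S (-A))
    (hW : IsCylindricalWiener P 𝓕 W) (hT : 0 ≤ T) {x : H} {n : H → H} (hn : Measurable n)
    (hn1 : ∀ y, ‖n y‖ ≤ 1) (h : IsSolution P 𝓕 W A Γ n T x X L) :
    IsMildSolution P 𝓕 W S Γ n T x X L := by
  have := he.countable
  have hreg := h.toIsReflectedPair.isRegularPath hn hn1
  have hSx : ContinuousOn (fun t => S t x) (Icc 0 T) :=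
    (hS.continuousOn x).mono Icc_subset_Ici_self
  refine ⟨h.toIsReflectedPair, fun t ω => X t ω - S t x
    + ∫ s in Ioc 0 t, S (t - s) (n (X s ω)) ∂(pathMeasure T (fun s => L s ω)), ?_, ?_, ?_⟩
  · have hk : ∀ k, ∀ᵐ ω ∂P, ∀ t ∈ Icc 0 T, inner ℝ (e k) (X t ω - S t x
        + ∫ s in Ioc 0 t, S (t - s) (n (X s ω)) ∂(pathMeasure T (fun s => L s ω)))
        = ouPath (lam k) (fun s => W s (e k) ω) t := by
      intro k
      obtain ⟨hm, hAe⟩ := he.apply_eq k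
      filter_upwards [hreg, hW.continuous (e k), h.equation ⟨e k, hm⟩] with ω hω hw heq
      have := hω.finite
      have := hω.nullSingleton
      refine (he.variational_iff_mild hS hT hω.continuousOn (hw.mono Icc_subset_Ici_self)
        hω.aestronglyMeasurable hω.norm_le x k).1 fun t ht => ?_
      obtain ⟨-, -, h3⟩ := heq t ht
      rw [h3, integral_inner
        (integrableOn_of_norm_le_one ht.2 hω.aestronglyMeasurable hω.norm_le), hAe,
        intervalIntegral.integral_of_le ht.1, ← integral_const_mul]
      simp only [inner_smul_left, conj_trivial]
    intro t ht
    exact he.isStochasticIntegral hS hW ht.1 fun k => (hk k).mono fun ω hω => hω t ht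
  · filter_upwards [hreg] with ω hω
    have := hω.finite
    have := hω.nullSingleton
    exact (hω.continuousOn.sub hSx).add
      (he.continuousOn_semigroup hS hω.aestronglyMeasurable hω.norm_le)
  · filter_upwards [hreg] with ω hω t ht
    have := hω.finite
    exact ⟨he.integrableOn_semigroup hS ht.2 hω.aestronglyMeasurable hω.norm_le, by abel⟩

theorem IsMildSolution.isSolution [IsFiniteMeasure P] [MeasurableSpace H] [BorelSpace H]
    [SecondCountableTopology H] (hA : IsSelfAdjoint A) (he : IsEigenbasis A e lam)
    (hS : IsSemigroupGeneratedBy S (-A)) (hW : IsCylindricalWiener P 𝓕 W) (hT : 0 ≤ T) {x : H}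
    {n : H → H} (hn : Measurable n) (hn1 : ∀ y, ‖n y‖ ≤ 1)
    (h : IsMildSolution P 𝓕 W S Γ n T x X L) : IsSolution P 𝓕 W A Γ n T x X L := by
  have := he.countable
  have hreg := h.toIsReflectedPair.isRegularPath hn hn1
  obtain ⟨Z, hZ, hZc, hmild⟩ := h.equation
  -- The noise identity holds at each time almost surely, hence along almost every path.
  have hZk : ∀ k, ∀ᵐ ω ∂P, ∀ t ∈ Icc 0 T,
      inner ℝ (e k) (Z t ω) = ouPath (lam k) (fun s => W s (e k) ω) t := by
    intro k
    refine ae_forall_eq_of_continuousOn ?_ ?_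
      fun t ht => he.inner_stochasticIntegral hS hW ht.1 (hZ t ht) k
    · filter_upwards [hZc] with ω hω
      exact continuousOn_const.inner (𝕜 := ℝ) hω
    · filter_upwards [hW.continuous (e k)] with ω hω
      exact continuousOn_ouPath hT (hω.mono Icc_subset_Ici_self)
  have hvar : ∀ k, ∀ᵐ ω ∂P, ∀ t ∈ Icc 0 T,
      inner ℝ (e k) (X t ω - x + ∫ s in Ioc 0 t, n (X s ω) ∂(pathMeasure T (fun s => L s ω)))
        + lam k * inner ℝ (e k) (∫ s in Ioc 0 t, X s ω) = W t (e k) ω := by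
    intro k
    filter_upwards [hreg, hW.continuous (e k), hZk k, hmild] with ω hω hw hz hm t ht
    have := hω.finite
    have := hω.nullSingleton
    have h1 := (he.variational_iff_mild hS hT hω.continuousOn (hw.mono Icc_subset_Ici_self)
      hω.aestronglyMeasurable hω.norm_le x k).2 (fun r hr => by
        rw [← hz r hr, (hm r hr).2]
        congr 1
        abel) t ht
    have hXi : IntegrableOn (fun s => X s ω) (Ioc 0 t) :=
      (hω.continuousOn.integrableOn_Icc).mono_set
        (Ioc_subset_Icc_self.trans (Icc_subset_Icc_right ht.2))
    rw [inner_add_right, h1, intervalIntegral.integral_of_le ht.1, integral_inner hXi]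
    ring
  refine ⟨h.toIsReflectedPair, fun l => ?_⟩
  have hl : ∀ᵐ ω ∂P, ∀ t ∈ Icc 0 T,
      inner ℝ (l : H) (X t ω - x
        + ∫ s in Ioc 0 t, n (X s ω) ∂(pathMeasure T (fun s => L s ω)))
        + inner ℝ (A l) (∫ s in Ioc 0 t, X s ω) = W t l ω := by
    refine ae_forall_eq_of_continuousOn ?_ ?_ fun t ht =>
      he.ae_eq_of_forall_eigenvector hA hW ht.1
        (fun k => (hvar k).mono fun ω hω => hω t ht) l
    · filter_upwards [hreg] with ω hω
      have := hω.finite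
      have := hω.nullSingleton
      exact (continuousOn_const.inner (𝕜 := ℝ) ((hω.continuousOn.sub continuousOn_const).add
        (continuousOn_integral_Ioc hω.aestronglyMeasurable hω.norm_le))).add
        (continuousOn_const.inner (𝕜 := ℝ)
          (intervalIntegral.continuousOn_primitive hω.continuousOn.integrableOn_Icc))
    · filter_upwards [hW.continuous l] with ω hω
      exact hω.mono Icc_subset_Ici_self
  filter_upwards [hreg, hl] with ω hω hlω t ht
  have := hω.finite
  have hqi := integrableOn_of_norm_le_one ht.2 hω.aestronglyMeasurable hω.norm_le
  have hXi : IntegrableOn (fun s => X s ω) (Ioc 0 t) :=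
    (hω.continuousOn.integrableOn_Icc).mono_set
      (Ioc_subset_Icc_self.trans (Icc_subset_Icc_right ht.2))
  refine ⟨Integrable.const_inner (𝕜 := ℝ) _ hqi, Integrable.const_inner (𝕜 := ℝ) _ hXi, ?_⟩
  rw [← hlω t ht, integral_inner hqi, integral_inner hXi, inner_add_right]
  ring

end Equivalence

end ReflectedOU

theorem theorem5p10
    {H : Type*} [NormedAddCommGroup H] [InnerProductSpace ℝ H] [CompleteSpace H]
    [TopologicalSpace.SeparableSpace H] [MeasurableSpace H] [BorelSpace H]
    {Ω : Type*} {mΩ : MeasurableSpace Ω} (P : Measure Ω) [IsProbabilityMeasure P]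
    (𝓕 : Filtration ℝ≥0 mΩ)
    (A : H →ₗ.[ℝ] H) (Ainv : H →L[ℝ] H) (hA : ReflectedOU.IsPositiveTraceInverse A Ainv)
    (S : ℝ → H →L[ℝ] H) (hS : ReflectedOU.IsSemigroupGeneratedBy S (-A))
    (μ : Measure H) (hμ : ReflectedOU.IsCenteredGaussian ((1 / 2 : ℝ) • Ainv) μ)
    (g : H → ℝ) (Γ : Set H) (hΓ : ReflectedOU.IsRegularConvexSet ((1 / 2 : ℝ) • Ainv) μ g Γ)
    (W : ℝ → H → Ω → ℝ) (hW : ReflectedOU.IsCylindricalWiener P 𝓕 W)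
    (T : ℝ) (hT : 0 < T) (x : H) (X : ℝ → Ω → H) (L : ℝ → Ω → ℝ) :
    ReflectedOU.IsSolution P 𝓕 W A Γ (ReflectedOU.exteriorNormal g) T x X L ↔
      ReflectedOU.IsMildSolution P 𝓕 W S Γ (ReflectedOU.exteriorNormal g) T x X L := by
  have : SecondCountableTopology H := UniformSpace.secondCountable_of_separable H
  obtain ⟨ι, e, lam, he⟩ := hA.exists_isEigenbasis
  have hn : Measurable (ReflectedOU.exteriorNormal g) :=
    ReflectedOU.measurable_exteriorNormal (hΓ.smooth.of_le (by exact_mod_cast le_top))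
  exact ⟨ReflectedOU.IsSolution.isMildSolution he hS hW hT.le hn
      (ReflectedOU.norm_exteriorNormal_le g),
    ReflectedOU.IsMildSolution.isSolution hA.selfAdjoint he hS hW hT.le hn
      (ReflectedOU.norm_exteriorNormal_le g)⟩
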